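/- Let $\Sigma$ be a finite alphabet and let $P:\Sigma^*\times\mathbb N\to\mathbb N$ be a computable function. Then the following two statements are equivalent. 1. There are a computable function $f:\mathbb N\to\mathbb N$, a constant $c\in\mathbb N$ and an algorithm that, given $(x,k)\in\Sigma^*\times\mathbb N$, outputs $P(x,k)$ in time at most $f(k)\cdot\max(|x|,1)^{c}$. 2. There are a computable function $f:\mathbb N\to\mathbb N$ and a polynomial-time algorithm that, given $(x,k)\in\Sigma^*\times\mathbb N$, either (a) outputs the number $P(x,k)$, or (b) outputs a pair $(x',k')\in\Sigma^*\times\mathbb N$ with $|x'|\le f(k)$, $k'\le f(k)$ and $P(x,k)=P(x',k')$, where the output indicates which of the two cases applies. Here algorithms are deterministic multi-tape (equivalently, multi-stack) Turing machines and time is the number of steps. In every pair $(x,k)$, whether input or output, $k$ is written in unary, so that the size of $(x,k)$ is $|x|+k$ and polynomial time means time polynomial in $|x|+k$. The values of $P$ are output in binary. -/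

import Mathlib

open Computability Turing

/-- The string encoding of an instance `(x, k) ∈ α* × ℕ`: the string `x` followed by `k` in unary
(over disjoint alphabets). Its length is `|x| + k`, the usual size of a parameterized instance. -/
def instanceEncoding (α : Type) : Encoding (List α × ℕ) (α ⊕ Bool) :=
  encodingProd (encodingList α) unaryEncodingNat

theorem length_instanceEncoding (α : Type) (x : List α) (k : ℕ) :
    ((instanceEncoding α).encode (x, k)).length = x.length + k := by
  have h : ∀ n : ℕ, (unaryEncodeNat n).length = n := fun n => unary_decode_encode_nat n
  simp [instanceEncoding, encodingProd, encodingList, unaryEncodingNat, h]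

/-- The encoding of a disjoint union: a leading tag symbol tells the summand, and the encoding of
the element follows. -/
def encodingSum {β γ Γ₁ Γ₂ : Type} (eb : Encoding β Γ₁) (ec : Encoding γ Γ₂) :
    Encoding (β ⊕ γ) (Bool ⊕ (Γ₁ ⊕ Γ₂)) where
  encode
    | .inl b => .inl false :: (eb.encode b).map fun s => .inr (.inl s)
    | .inr c => .inl true :: (ec.encode c).map fun s => .inr (.inr s)
  decode
    | .inl false :: l =>
        (eb.decode (l.filterMap fun s => s.getRight?.bind Sum.getLeft?)).map .inl
    | .inl true :: l =>
        (ec.decode (l.filterMap fun s => s.getRight?.bind Sum.getRight?)).map .inr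
    | _ => none
  decode_encode y := by
    cases y <;> simp [List.filterMap_map, Function.comp_def]

/-- `P : α* × ℕ → ℕ` is a (total) computable function: some Turing machine (Mathlib's multi-stack
machine `FinTM2`), started on the encoding of `(x, k)`, halts and outputs `P (x, k)` in binary. -/
def ComputableCounting {α : Type} (P : List α × ℕ → ℕ) : Prop :=
  Nonempty (TM2Computable (instanceEncoding α).encode encodingNatBool.encode P)

/-- `P` is fixed-parameter tractable: for some computable `f` and some constant `c`, a Turing machine
outputs `P (x, k)` in binary within `f k * |x| ^ c` steps, for every instance `(x, k)`. In the bound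
`|x|` is read as `1` for the empty string, since no machine halts within `0` steps. -/
def FPTCounting {α : Type} (P : List α × ℕ → ℕ) : Prop :=
  ∃ f : ℕ → ℕ, Computable f ∧
    ∃ (M : TM2ComputableAux (α ⊕ Bool) Bool) (c : ℕ), ∀ (x : List α) (k : ℕ),
      Nonempty (TM2OutputsInTime M.tm
        (((instanceEncoding α).encode (x, k)).map M.inputAlphabet.symm)
        (some ((encodingNatBool.encode (P (x, k))).map M.outputAlphabet.symm))
        (f k * max x.length 1 ^ c))

/-- `P` has a counting kernel: for some computable `f` there is a polynomial-time algorithm whose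
output on `(x, k)` is either the number `P (x, k)` or an instance `(x', k')` with `|x'|, k' ≤ f k`
and the same value. -/
def HasCountingKernel {α : Type} (P : List α × ℕ → ℕ) : Prop :=
  ∃ f : ℕ → ℕ, Computable f ∧
    ∃ A : List α × ℕ → ℕ ⊕ (List α × ℕ),
      Nonempty (TM2ComputableInPolyTime (instanceEncoding α).encode
        (encodingSum encodingNatBool (instanceEncoding α)).encode A) ∧
      ∀ (x : List α) (k : ℕ),
        A (x, k) = .inl (P (x, k)) ∨
        ∃ (x' : List α) (k' : ℕ), A (x, k) = .inr (x', k') ∧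
          x'.length ≤ f k ∧ k' ≤ f k ∧ P (x, k) = P (x', k')

open Function (update)

/-!
To compute a kernel, clock the given algorithm: run it on `(x, k)` for `n ^ (c + 1)` steps, where
`n = |x| + k + 1`. If it halts in time, its output is the value. Otherwise
`n ^ (c + 1) ≤ f k * max |x| 1 ^ c ≤ f k * n ^ c`, hence `n ≤ f k` and the instance is its own
kernel. Conversely, run the kernelization and, if it returns an instance, run any machine that
computes `P` on this instance. As there are only finitely many instances of size at most `f k`, and
since a machine can be simulated by a primitive recursive function, the running time of the second
phase has a bound that is computable from `f k`.
-/

section Runs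

variable {σ τ : Type*} {f : σ → Option σ} {m n t t' : ℕ} {a b c : σ}

/-- `StepsTo f n a b`: the partial step function `f` takes `a` to `b` in exactly `n` steps. -/
def StepsTo (f : σ → Option σ) (n : ℕ) (a b : σ) : Prop :=
  (flip bind f)^[n] (some a) = some b

/-- `StepsWithin f t a b`: the partial step function `f` takes `a` to `b` in at most `t` steps. -/
def StepsWithin (f : σ → Option σ) (t : ℕ) (a b : σ) : Prop :=
  ∃ n ≤ t, StepsTo f n a b

namespace StepsTo

theorem refl (a : σ) : StepsTo f 0 a a := rfl

theorem eq_of_zero (h : StepsTo f 0 a b) : a = b := Option.some.inj h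

theorem single (h : f a = some b) : StepsTo f 1 a b := h

theorem trans (h : StepsTo f m a b) (h' : StepsTo f n b c) : StepsTo f (m + n) a c := by
  rw [StepsTo, add_comm, Function.iterate_add_apply, h, h']

theorem head (h : f a = some b) (h' : StepsTo f n b c) : StepsTo f (n + 1) a c :=
  add_comm 1 n ▸ (single h).trans h'

theorem tail (h : StepsTo f n a b) (h' : f b = some c) : StepsTo f (n + 1) a c :=
  h.trans (single h')

theorem exists_tail (h : StepsTo f (n + 1) a c) : ∃ b, StepsTo f n a b ∧ f b = some c := by
  rw [StepsTo, Function.iterate_succ_apply'] at h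
  exact Option.bind_eq_some_iff.mp h

theorem exists_split (h : StepsTo f (m + n) a c) : ∃ b, StepsTo f m a b ∧ StepsTo f n b c := by
  induction n generalizing c with
  | zero => exact ⟨c, h, refl c⟩
  | succ n ih =>
    obtain ⟨d, had, hdc⟩ := h.exists_tail
    obtain ⟨b, hab, hbd⟩ := ih had
    exact ⟨b, hab, hbd.tail hdc⟩

theorem exists_head (h : StepsTo f (n + 1) a c) : ∃ b, f a = some b ∧ StepsTo f n b c :=
  exists_split (add_comm n 1 ▸ h)

theorem map {g : τ → Option τ} {φ : σ → τ} (hφ : ∀ a b, f a = some b → g (φ a) = some (φ b))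
    (h : StepsTo f n a b) : StepsTo g n (φ a) (φ b) := by
  induction n generalizing b with
  | zero => exact h.eq_of_zero ▸ refl _
  | succ n ih =>
    obtain ⟨d, had, hdb⟩ := h.exists_tail
    exact (ih had).tail (hφ d b hdb)

theorem within (h : StepsTo f n a b) : StepsWithin f n a b := ⟨n, le_rfl, h⟩

end StepsTo

namespace StepsWithin

theorem mono (h : StepsWithin f t a b) (ht : t ≤ t') : StepsWithin f t' a b :=
  let ⟨n, hn, hs⟩ := h
  ⟨n, hn.trans ht, hs⟩

theorem trans (h : StepsWithin f t a b) (h' : StepsWithin f t' b c) :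
    StepsWithin f (t + t') a c :=
  let ⟨m, hm, hs⟩ := h
  let ⟨n, hn, hs'⟩ := h'
  ⟨m + n, add_le_add hm hn, hs.trans hs'⟩

theorem head (h : f a = some b) (h' : StepsWithin f t b c) : StepsWithin f (t + 1) a c :=
  add_comm 1 t ▸ (StepsTo.single h).within.trans h'

end StepsWithin

end Runs

section Outputs

theorem update_nil_nil {K : Type*} [DecidableEq K] {Γ : K → Type*} (k : K) :
    update (fun k => ([] : List (Γ k))) k [] = fun _ => [] :=
  Function.update_eq_self k _

/-- The configuration of a multi-stack machine all of whose stacks are empty, except possibly for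
stack `k`, which contains `s`. -/
def singleStackCfg {K : Type*} [DecidableEq K] {Γ : K → Type*} {Λ σ : Type*} (l : Option Λ) (v : σ)
    (k : K) (s : List (Γ k)) : TM2.Cfg Γ Λ σ :=
  ⟨l, v, update (fun _ => []) k s⟩

theorem initList_eq_singleStackCfg (tm : FinTM2) (s : List (tm.Γ tm.k₀)) :
    initList tm s = singleStackCfg (some tm.main) tm.initialState tm.k₀ s := by
  rw [initList, singleStackCfg]
  congr 1
  funext k
  by_cases h : k = tm.k₀
  · subst h; simp
  · simp [h]

theorem haltList_eq_singleStackCfg (tm : FinTM2) (s : List (tm.Γ tm.k₁)) :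
    haltList tm s = singleStackCfg none tm.initialState tm.k₁ s := by
  rw [haltList, singleStackCfg]
  congr 1
  funext k
  by_cases h : k = tm.k₁
  · subst h; simp
  · simp [h]

variable {β γ : Type}

/-- The configuration in which `M` starts on the word `w`. -/
def startCfg (M : TM2ComputableAux β γ) (w : List β) : M.tm.Cfg :=
  singleStackCfg (some M.tm.main) M.tm.initialState M.tm.k₀ (w.map M.inputAlphabet.symm)

/-- The configuration in which `M` halts with the output `u`. -/
def haltCfg (M : TM2ComputableAux β γ) (u : List γ) : M.tm.Cfg :=
  singleStackCfg none M.tm.initialState M.tm.k₁ (u.map M.outputAlphabet.symm)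

/-- `M` outputs `u` on the input `w` after exactly `t` steps. -/
def OutputsAfter (M : TM2ComputableAux β γ) (t : ℕ) (w : List β) (u : List γ) : Prop :=
  StepsTo (TM2.step M.tm.m) t (startCfg M w) (haltCfg M u)

/-- `M` outputs `u` on the input `w` after at most `t` steps. -/
def OutputsWithin (M : TM2ComputableAux β γ) (t : ℕ) (w : List β) (u : List γ) : Prop :=
  StepsWithin (TM2.step M.tm.m) t (startCfg M w) (haltCfg M u)

variable {M : TM2ComputableAux β γ} {t t' : ℕ} {w : List β} {u : List γ}

theorem nonempty_TM2OutputsInTime_iff :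
    Nonempty (TM2OutputsInTime M.tm (w.map M.inputAlphabet.symm)
      (some (u.map M.outputAlphabet.symm)) t) ↔ OutputsWithin M t w u := by
  rw [OutputsWithin, startCfg, haltCfg, ← initList_eq_singleStackCfg, ← haltList_eq_singleStackCfg]
  exact ⟨fun ⟨h⟩ => ⟨h.steps, h.steps_le_m, h.evals_in_steps⟩,
    fun ⟨n, hn, h⟩ => ⟨⟨⟨n, h⟩, hn⟩⟩⟩

theorem OutputsWithin.mono (h : OutputsWithin M t w u) (ht : t ≤ t') : OutputsWithin M t' w u :=
  StepsWithin.mono h ht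

end Outputs

section Growth

variable {K : Type*} [DecidableEq K] {Γ : K → Type*} {Λ σ : Type*}

/-- A bound on the number of symbols that a statement pushes when it is executed. -/
def pushBound : TM2.Stmt Γ Λ σ → ℕ
  | .push _ _ q => pushBound q + 1
  | .peek _ _ q => pushBound q
  | .pop _ _ q => pushBound q
  | .load _ q => pushBound q
  | .branch _ q₁ q₂ => max (pushBound q₁) (pushBound q₂)
  | .goto _ => 0
  | .halt => 0

theorem length_stepAux_stk_le (q : TM2.Stmt Γ Λ σ) (v : σ) (S : ∀ k, List (Γ k)) (k : K) :
    ((TM2.stepAux q v S).stk k).length ≤ (S k).length + pushBound q := by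
  induction q generalizing v S with
  | push k' f q ih =>
    have hpush : (update S k' (f v :: S k') k).length ≤ (S k).length + 1 := by
      by_cases h : k = k'
      · subst h; simp
      · simp [h]
    calc _ ≤ _ := ih v (update S k' (f v :: S k'))
      _ ≤ _ := by rw [pushBound]; omega
  | peek _ _ _ ih => exact ih _ _
  | pop k' f q ih =>
    have hpop : (update S k' (S k').tail k).length ≤ (S k).length := by
      by_cases h : k = k'
      · subst h; simp
      · simp [h]
    exact (ih _ _).trans (Nat.add_le_add_right hpop _)
  | load _ _ ih => exact ih _ _
  | branch f q₁ q₂ ih₁ ih₂ =>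
    rw [TM2.stepAux, pushBound]
    cases f v
    · exact (ih₂ v S).trans (by simp)
    · exact (ih₁ v S).trans (by simp)
  | goto _ => exact le_rfl
  | halt => exact le_rfl

theorem exists_growth_bound [Finite Λ] (m : Λ → TM2.Stmt Γ Λ σ) :
    ∃ B, ∀ n a b, StepsTo (TM2.step m) n a b →
      ∀ k, (b.stk k).length ≤ (a.stk k).length + n * B := by
  obtain ⟨B, hB⟩ := (Set.finite_range fun l => pushBound (m l)).bddAbove
  have hstep : ∀ a b, TM2.step m a = some b → ∀ k, (b.stk k).length ≤ (a.stk k).length + B := by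
    rintro ⟨_ | l, v, S⟩ b h k
    · cases h
    · cases h
      exact (length_stepAux_stk_le (m l) v S k).trans
        (Nat.add_le_add_left (hB (Set.mem_range_self l)) _)
  refine ⟨B, fun n => ?_⟩
  induction n with
  | zero => intro a b h k; simp [h.eq_of_zero]
  | succ n ih =>
    intro a c h k
    obtain ⟨b, hab, hbc⟩ := h.exists_tail
    calc (c.stk k).length ≤ (b.stk k).length + B := hstep b c hbc k
      _ ≤ (a.stk k).length + n * B + B := Nat.add_le_add_right (ih a b hab k) B
      _ = (a.stk k).length + (n + 1) * B := by ring

theorem length_singleStackCfg_stk_le (l : Option Λ) (v : σ) (k : K) (s : List (Γ k)) (k' : K) :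
    ((singleStackCfg l v k s).stk k').length ≤ s.length := by
  rw [singleStackCfg]
  by_cases h : k' = k
  · subst h; simp
  · simp [h]

end Growth

/-- `B` bounds the growth of the stacks of `M` per step of a run. -/
def IsGrowthBound {β γ : Type} (M : TM2ComputableAux β γ) (B : ℕ) : Prop :=
  ∀ (w : List β) (t : ℕ) (a : M.tm.Cfg), StepsTo (TM2.step M.tm.m) t (startCfg M w) a →
    ∀ k, (a.stk k).length ≤ w.length + t * B

theorem exists_isGrowthBound {β γ : Type} (M : TM2ComputableAux β γ) : ∃ B, IsGrowthBound M B := by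
  have := M.tm.ΛFin
  obtain ⟨B, hB⟩ := exists_growth_bound M.tm.m
  refine ⟨B, fun w t a h k => (hB t _ a h k).trans (Nat.add_le_add_right ?_ _)⟩
  exact (length_singleStackCfg_stk_le _ _ _ _ k).trans (List.length_map _).le

theorem IsGrowthBound.length_output_le {β γ : Type} {M : TM2ComputableAux β γ} {B t : ℕ}
    {w : List β} {u : List γ} (hB : IsGrowthBound M B) (h : OutputsAfter M t w u) :
    u.length ≤ w.length + t * B := by
  simpa [haltCfg, singleStackCfg] using hB w t _ h M.tm.k₁

section Embedding

variable {K K₂ : Type*} [DecidableEq K] [DecidableEq K₂] {Γ₂ : K₂ → Type*} {Λ Λ₂ σ σ₂ : Type*}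

/-- The data needed to run a program with stacks `K`, labels `Λ` and states `σ` as a part of a
program with stacks `K₂`, labels `Λ₂` and states `σ₂`. Instead of halting, the embedded program goes
to the label `exit`, if there is one. -/
structure ProgramEmbedding (K K₂ Λ Λ₂ σ σ₂ : Type*) where
  /-- The stack that plays the role of a given stack. -/
  stack : K → K₂
  /-- The label that plays the role of a given label. -/
  label : Λ → Λ₂
  /-- The label that replaces halting. -/
  exit : Option Λ₂
  /-- The part of the state that the embedded program sees. -/
  get : σ₂ → σ
  /-- Updates the part of the state that the embedded program sees. -/
  set : σ → σ₂ → σ₂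

namespace ProgramEmbedding

/-- The statement that a statement of the embedded program becomes. -/
def lift (E : ProgramEmbedding K K₂ Λ Λ₂ σ σ₂) :
    TM2.Stmt (fun k => Γ₂ (E.stack k)) Λ σ → TM2.Stmt Γ₂ Λ₂ σ₂
  | .push k f q => .push (E.stack k) (fun v => f (E.get v)) (E.lift q)
  | .peek k f q => .peek (E.stack k) (fun v o => E.set (f (E.get v) o) v) (E.lift q)
  | .pop k f q => .pop (E.stack k) (fun v o => E.set (f (E.get v) o) v) (E.lift q)
  | .load f q => .load (fun v => E.set (f (E.get v)) v) (E.lift q)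
  | .branch f q₁ q₂ => .branch (fun v => f (E.get v)) (E.lift q₁) (E.lift q₂)
  | .goto f => .goto fun v => E.label (f (E.get v))
  | .halt => E.exit.elim .halt fun l => .goto fun _ => l

variable {E : ProgramEmbedding K K₂ Λ Λ₂ σ σ₂}

/-- A choice of those parts of a state and of the stacks that an embedded program does not see. -/
structure Frame (E : ProgramEmbedding K K₂ Λ Λ₂ σ σ₂) (Γ₂ : K₂ → Type*) where
  /-- The state with a given visible part. -/
  state : σ → σ₂
  /-- The stacks with given visible stacks. -/
  stk : (∀ k, List (Γ₂ (E.stack k))) → ∀ k', List (Γ₂ k')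
  get_state : ∀ v, E.get (state v) = v
  set_state : ∀ v w, E.set v (state w) = state v
  stk_apply : ∀ S k, stk S (E.stack k) = S k
  update_stk : ∀ S k x, update (stk S) (E.stack k) x = stk (update S k x)

/-- The configuration that a configuration of the embedded program becomes. -/
def Frame.cfg (F : E.Frame Γ₂) (a : TM2.Cfg (fun k => Γ₂ (E.stack k)) Λ σ) : TM2.Cfg Γ₂ Λ₂ σ₂ :=
  ⟨a.l.elim E.exit fun l => some (E.label l), F.state a.var, F.stk a.stk⟩

theorem stepAux_lift (F : E.Frame Γ₂) (q : TM2.Stmt (fun k => Γ₂ (E.stack k)) Λ σ) (v : σ)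
    (S : ∀ k, List (Γ₂ (E.stack k))) :
    TM2.stepAux (E.lift q) (F.state v) (F.stk S) = F.cfg (TM2.stepAux q v S) := by
  induction q generalizing v S with
  | push k f q ih => simp only [lift, TM2.stepAux, F.get_state, F.stk_apply, F.update_stk, ih]
  | peek k f q ih => simp only [lift, TM2.stepAux, F.get_state, F.set_state, F.stk_apply, ih]
  | pop k f q ih =>
    simp only [lift, TM2.stepAux, F.get_state, F.set_state, F.stk_apply, F.update_stk, ih]
  | load f q ih => simp only [lift, TM2.stepAux, F.get_state, F.set_state, ih]
  | branch f q₁ q₂ ih₁ ih₂ =>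
    simp only [lift, TM2.stepAux, F.get_state]
    cases f v
    · exact ih₂ v S
    · exact ih₁ v S
  | goto f => simp only [lift, TM2.stepAux, F.get_state, Frame.cfg, Option.elim]
  | halt =>
    rw [lift]
    cases h : E.exit <;> simp [Frame.cfg, TM2.stepAux, h]

theorem stepsTo_cfg (F : E.Frame Γ₂) {m : Λ → TM2.Stmt (fun k => Γ₂ (E.stack k)) Λ σ}
    {m' : Λ₂ → TM2.Stmt Γ₂ Λ₂ σ₂} (hm : ∀ l, m' (E.label l) = E.lift (m l)) {n : ℕ}
    {a b : TM2.Cfg (fun k => Γ₂ (E.stack k)) Λ σ} (h : StepsTo (TM2.step m) n a b) :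
    StepsTo (TM2.step m') n (F.cfg a) (F.cfg b) := by
  refine h.map ?_
  rintro ⟨_ | l, v, S⟩ b hb
  · cases hb
  · cases hb
    simp only [Frame.cfg, Option.elim, TM2.step, hm]
    rw [stepAux_lift]
    rfl

end ProgramEmbedding

end Embedding

section Drain

variable {K : Type*} [DecidableEq K] {Γ : K → Type*} {Λ σ : Type*}

/-- A Boolean component of a state. -/
structure StateFlag (σ : Type*) where
  get : σ → Bool
  set : Bool → σ → σ
  get_set : ∀ b v, get (set b v) = b

/-- Pops the stacks in `ks` and sets the flag if one of them is not empty. -/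
def popAll (F : StateFlag σ) (q : TM2.Stmt Γ Λ σ) : List K → TM2.Stmt Γ Λ σ
  | [] => q
  | k :: ks => .pop k (fun v o => F.set (F.get v || o.isSome) v) (popAll F q ks)

theorem exists_stepAux_popAll (F : StateFlag σ) (q : TM2.Stmt Γ Λ σ) {ks : List K} (hks : ks.Nodup)
    (v : σ) (S : ∀ k, List (Γ k)) :
    ∃ w, (F.get w = true ↔ F.get v = true ∨ ∃ k ∈ ks, S k ≠ []) ∧
      TM2.stepAux (popAll F q ks) v S =
        TM2.stepAux q w fun k => if k ∈ ks then (S k).tail else S k := by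
  induction ks generalizing v S with
  | nil => exact ⟨v, by simp, by simp [popAll]⟩
  | cons k ks ih =>
    obtain ⟨hk, hks⟩ := List.nodup_cons.1 hks
    obtain ⟨w, hw, h⟩ := ih hks (F.set (F.get v || (S k).head?.isSome) v) (update S k (S k).tail)
    refine ⟨w, hw.trans ?_, ?_⟩
    · have hrest : (∃ k' ∈ ks, update S k (S k).tail k' ≠ []) ↔ ∃ k' ∈ ks, S k' ≠ [] :=
        exists_congr fun k' => and_congr_right fun hk' => by
          rw [Function.update_of_ne (ne_of_mem_of_not_mem hk' hk)]
      rw [F.get_set, hrest]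
      simp [or_assoc]
    · rw [popAll, TM2.stepAux, h]
      congr 1
      funext k'
      by_cases h : k' = k
      · subst h; simp [hk]
      · simp [h]

/-- Run at the label `l`, pops the stacks in `ks` until they are empty, then resets the state to
`v₀` and goes to `l'`. -/
def drain (F : StateFlag σ) (v₀ : σ) (l l' : Λ) (ks : List K) : TM2.Stmt Γ Λ σ :=
  .load (F.set false) <| popAll F
    (.branch F.get (.goto fun _ => l) (.load (fun _ => v₀) (.goto fun _ => l'))) ks

theorem step_drain {m : Λ → TM2.Stmt Γ Λ σ} {F : StateFlag σ} {v₀ : σ} {l l' : Λ} {ks : List K}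
    (hm : m l = drain F v₀ l l' ks) (hks : ks.Nodup) (v : σ) (S : ∀ k, List (Γ k)) :
    ((∀ k ∈ ks, S k = []) ∧ TM2.step m ⟨some l, v, S⟩ = some ⟨some l', v₀, S⟩) ∨
      ((∃ k ∈ ks, S k ≠ []) ∧ ∃ w, TM2.step m ⟨some l, v, S⟩ =
        some ⟨some l, w, fun k => if k ∈ ks then (S k).tail else S k⟩) := by
  obtain ⟨w, hw, h⟩ := exists_stepAux_popAll F
    (.branch F.get (.goto fun _ => l) (.load (fun _ => v₀) (.goto fun _ => l'))) hks
    (F.set false v) S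
  rw [F.get_set] at hw
  rw [TM2.step, hm, drain, TM2.stepAux, h, TM2.stepAux]
  cases hb : F.get w
  · have hnil : ∀ k ∈ ks, S k = [] := by simpa [hb] using hw
    have htail : (fun k => if k ∈ ks then (S k).tail else S k) = S := by
      funext k
      by_cases hk : k ∈ ks <;> simp [hk, hnil]
    exact .inl ⟨hnil, by simp [htail]⟩
  · exact .inr ⟨by simpa [hb] using hw, w, by simp⟩

theorem stepsWithin_drain {m : Λ → TM2.Stmt Γ Λ σ} {F : StateFlag σ} {v₀ : σ} {l l' : Λ}
    {ks : List K} (hm : m l = drain F v₀ l l' ks) (hks : ks.Nodup) {N : ℕ} {v : σ}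
    {S S' : ∀ k, List (Γ k)} (hS : ∀ k ∈ ks, (S k).length ≤ N) (hnil : ∀ k ∈ ks, S' k = [])
    (heq : ∀ k ∉ ks, S' k = S k) :
    StepsWithin (TM2.step m) (N + 1) ⟨some l, v, S⟩ ⟨some l', v₀, S'⟩ := by
  have of_empty (hempty : ∀ k ∈ ks, S k = []) : S' = S := funext fun k =>
    if hk : k ∈ ks then (hnil k hk).trans (hempty k hk).symm else heq k hk
  induction N generalizing v S with
  | zero =>
    obtain ⟨hempty, hstep⟩ | ⟨⟨k, hk, hne⟩, -⟩ := step_drain hm hks v S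
    · exact of_empty hempty ▸ (StepsTo.single hstep).within
    · exact absurd (List.length_eq_zero_iff.1 (Nat.le_zero.1 (hS k hk))) hne
  | succ N ih =>
    obtain ⟨hempty, hstep⟩ | ⟨-, w, hstep⟩ := step_drain hm hks v S
    · have hdone : StepsWithin (TM2.step m) 1 ⟨some l, v, S⟩ ⟨some l', v₀, S'⟩ :=
        of_empty hempty ▸ (StepsTo.single hstep).within
      exact hdone.mono (Nat.le_add_left 1 _)
    · have heq' (k) (hk : k ∉ ks) : S' k = if k ∈ ks then (S k).tail else S k := by
        rw [heq k hk, if_neg hk]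
      refine .head hstep (ih (fun k hk => ?_) heq' fun hempty => funext fun k => ?_)
      · simpa [hk] using hS k hk
      · by_cases hk : k ∈ ks
        · rw [hnil k hk, hempty k hk]
        · exact heq' k hk

end Drain

section Tagged

variable {γ δ : Type}

/-- The word over `Bool ⊕ (γ ⊕ δ)` that stands for a word over `γ` or a word over `δ`: a tag symbol
that tells which of the two it is, followed by the word itself. -/
def tagged : List γ ⊕ List δ → List (Bool ⊕ (γ ⊕ δ))
  | .inl u => .inl false :: u.map fun s => .inr (.inl s)
  | .inr w => .inl true :: w.map fun s => .inr (.inr s)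

theorem encodingSum_encode {X Y : Type} (eX : Encoding X γ) (eY : Encoding Y δ) (z : X ⊕ Y) :
    (encodingSum eX eY).encode z = tagged (z.map eX.encode eY.encode) := by
  cases z <;> rfl

end Tagged

/-- An odometer with `d` digits. Each digit consists of two piles of tokens, and its value is the
size of the pile that `dir` selects. Since a digit is reset from zero to its maximum by swapping the
roles of its piles, the odometer can be turned back in a single step of a multi-stack machine. -/
structure Clock (d : ℕ) where
  dir : Fin d → Bool
  count : Fin d → Bool → ℕ

namespace Clock

variable {d n : ℕ}

/-- Decreases a digit by one. -/
def moveToken (C : Clock d) (i : Fin d) : Clock d where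
  dir := C.dir
  count := update C.count i (update (update (C.count i) (C.dir i) (C.count i (C.dir i) - 1))
    (!C.dir i) (C.count i (!C.dir i) + 1))

/-- Swaps the roles of the two piles of a digit. -/
def flip (C : Clock d) (i : Fin d) : Clock d where
  dir := update C.dir i (!C.dir i)
  count := C.count

/-- Turns back the odometer with digits `is` (least significant digit first) by one. The first
component tells whether this was possible, that is, whether some digit was not zero. -/
def advance : List (Fin d) → Clock d → Bool × Clock d
  | [], C => (false, C)
  | i :: is, C => if C.count i (C.dir i) = 0 then advance is (C.flip i) else (true, C.moveToken i)

/-- All digits have the maximum `n`. -/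
def Total (n : ℕ) (C : Clock d) : Prop :=
  ∀ i b, C.count i b + C.count i (!b) = n

/-- The number that the digits `is` represent in base `n + 1`. -/
def remaining (n : ℕ) (C : Clock d) : List (Fin d) → ℕ
  | [] => 0
  | i :: is => C.count i (C.dir i) + (n + 1) * remaining n C is

/-- The clock all of whose digits have the value `n` and the maximum `n`. -/
def full (d n : ℕ) : Clock d where
  dir _ := true
  count _ b := bif b then n else 0

theorem total_full : (full d n).Total n := by
  intro i b; cases b <;> simp [full]

theorem remaining_full_add_one (is : List (Fin d)) :
    (full d n).remaining n is + 1 = (n + 1) ^ is.length := by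
  induction is with
  | nil => rfl
  | cons i is ih =>
    rw [remaining, List.length_cons, pow_succ, ← ih]
    simp only [full, cond_true]
    ring

theorem count_moveToken_dir (C : Clock d) (i : Fin d) :
    (C.moveToken i).count i (C.dir i) = C.count i (C.dir i) - 1 := by
  simp [moveToken]

theorem count_moveToken_not_dir (C : Clock d) (i : Fin d) :
    (C.moveToken i).count i (!C.dir i) = C.count i (!C.dir i) + 1 := by
  simp [moveToken]

theorem Total.moveToken {C : Clock d} (hC : C.Total n) {i : Fin d} (hi : C.count i (C.dir i) ≠ 0) :
    (C.moveToken i).Total n := by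
  intro j b
  by_cases hj : j = i
  · subst hj
    have := hC j (C.dir j)
    have := C.count_moveToken_dir j
    have := C.count_moveToken_not_dir j
    obtain rfl | rfl := Bool.eq_or_eq_not b (C.dir j)
    · omega
    · rw [Bool.not_not]
      omega
  · simpa [Clock.moveToken, hj] using hC j b

theorem Total.advance {C : Clock d} (hC : C.Total n) (is : List (Fin d)) :
    (Clock.advance is C).2.Total n := by
  induction is generalizing C with
  | nil => exact hC
  | cons i is ih =>
    rw [Clock.advance]
    split_ifs with hi
    · exact ih (C := C.flip i) hC
    · exact hC.moveToken hi

theorem Total.count_le {C : Clock d} (hC : C.Total n) (i : Fin d) (b : Bool) : C.count i b ≤ n :=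
  (Nat.le_add_right _ _).trans (hC i b).le

theorem remaining_congr {C C' : Clock d} {is : List (Fin d)}
    (h : ∀ i ∈ is, C.dir i = C'.dir i ∧ C.count i = C'.count i) :
    C.remaining n is = C'.remaining n is := by
  induction is with
  | nil => rfl
  | cons i is ih =>
    obtain ⟨hi, his⟩ := List.forall_mem_cons.1 h
    rw [remaining, remaining, ih his, hi.1, hi.2]

theorem advance_of_notMem {is : List (Fin d)} {i : Fin d} (hi : i ∉ is) (C : Clock d) :
    (advance is C).2.dir i = C.dir i ∧ (advance is C).2.count i = C.count i := by
  induction is generalizing C with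
  | nil => exact ⟨rfl, rfl⟩
  | cons j is ih =>
    obtain ⟨hij, his⟩ : i ≠ j ∧ i ∉ is := by simpa using hi
    rw [advance]
    split_ifs
    · simpa [flip, hij] using ih his (C.flip j)
    · simp [moveToken, hij]

theorem remaining_flip {is : List (Fin d)} {i : Fin d} (hi : i ∉ is) (C : Clock d) :
    (C.flip i).remaining n is = C.remaining n is :=
  remaining_congr fun j hj => by simp [flip, ne_of_mem_of_not_mem hj hi]

theorem remaining_moveToken {is : List (Fin d)} {i : Fin d} (hi : i ∉ is) (C : Clock d) :
    (C.moveToken i).remaining n is = C.remaining n is :=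
  remaining_congr fun j hj => by simp [moveToken, ne_of_mem_of_not_mem hj hi]

theorem remaining_eq_zero_of_advance {is : List (Fin d)} (his : is.Nodup) {C : Clock d}
    (h : (advance is C).1 = false) : C.remaining n is = 0 := by
  induction is generalizing C with
  | nil => rfl
  | cons i is ih =>
    obtain ⟨hi, his⟩ := List.nodup_cons.1 his
    rw [advance] at h
    split_ifs at h with h0
    rw [remaining, h0, ← remaining_flip hi, ih his h, mul_zero, add_zero]

theorem remaining_advance_add_one {is : List (Fin d)} (his : is.Nodup) {C : Clock d}
    (hC : C.Total n) (h : (advance is C).1 = true) :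
    (advance is C).2.remaining n is + 1 = C.remaining n is := by
  induction is generalizing C with
  | nil => cases h
  | cons i is ih =>
    obtain ⟨hi, his⟩ := List.nodup_cons.1 his
    rw [advance] at h ⊢
    split_ifs at h ⊢ with h0
    · have hreset : (C.flip i).count i ((C.flip i).dir i) = n := by
        have := hC i (C.dir i)
        rw [h0, zero_add] at this
        simpa [flip] using this
      have hrest := ih his (C := C.flip i) hC h
      rw [remaining, remaining, h0, (advance_of_notMem hi _).1, (advance_of_notMem hi _).2, hreset,
        ← remaining_flip hi C, ← hrest]
      ring
    · have hdigit : (C.moveToken i).count i ((C.moveToken i).dir i) + 1 = C.count i (C.dir i) := by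
        rw [show (C.moveToken i).dir i = C.dir i from rfl, count_moveToken_dir]
        omega
      rw [remaining, remaining, remaining_moveToken hi, ← hdigit]
      ring

end Clock

namespace Clocked

/-- The stacks that a clocked machine has in addition to those of the machine that it runs: its
input, the reversed input, buffers for the two possible outputs, its output, and the piles of a
clock. The buffer `buf b` holds the word that is output with the tag `b`. -/
inductive Stack (d : ℕ)
  | inp
  | rev
  | buf (b : Bool)
  | out
  | clk (i : Fin d) (b : Bool)
  deriving DecidableEq, Fintype

/-- The labels of a clocked machine, one or more for each phase of its run. -/
inductive Label (Λ : Type)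
  | scan
  | fill
  | sim (l : Λ)
  | collect
  | clean (b : Bool)
  | emit (b : Bool)
  deriving Fintype

/-- The states of a clocked machine: the state of the machine that it runs, the directions of the
digits of the clock, the last symbol that was popped, and a flag. -/
structure State (σ β γ : Type) (d : ℕ) where
  inner : σ
  dir : Fin d → Bool
  sym : Option (γ ⊕ β)
  flag : Bool

instance {σ β γ : Type} {d : ℕ} [Finite σ] [Finite β] [Finite γ] : Finite (State σ β γ d) :=
  Finite.of_injective (fun v => (v.inner, v.dir, v.sym, v.flag)) fun v w h => by
    cases v; cases w; simpa using h

variable {β γ : Type} {M : TM2ComputableAux β γ} {d : ℕ}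

/-- The alphabets of the stacks of a clocked machine. -/
abbrev Alphabet (M : TM2ComputableAux β γ) (d : ℕ) : M.tm.K ⊕ Stack d → Type
  | .inl k => M.tm.Γ k
  | .inr .inp => β
  | .inr .rev => β
  | .inr (.buf _) => γ ⊕ β
  | .inr .out => Bool ⊕ (γ ⊕ β)
  | .inr (.clk _ _) => Unit

/-- The statements of the machine that runs `M` with a clock with `d` digits. -/
abbrev Stmt (M : TM2ComputableAux β γ) (d : ℕ) : Type :=
  TM2.Stmt (Alphabet M d) (Label M.tm.Λ) (State M.tm.σ β γ d)

/-- The configurations of the machine that runs `M` with a clock with `d` digits. -/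
abbrev Cfg (M : TM2ComputableAux β γ) (d : ℕ) : Type :=
  TM2.Cfg (Alphabet M d) (Label M.tm.Λ) (State M.tm.σ β γ d)

/-- The contents of the stacks of a clocked machine, with a pile of tokens given by its size. -/
structure Stacks (M : TM2ComputableAux β γ) (d : ℕ) where
  sim : ∀ k, List (M.tm.Γ k)
  inp : List β
  rev : List β
  buf : Bool → List (γ ⊕ β)
  out : List (Bool ⊕ (γ ⊕ β))
  clk : Fin d → Bool → ℕ

namespace Stacks

/-- The contents of a given stack. -/
def contents (T : Stacks M d) : ∀ k, List (Alphabet M d k)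
  | .inl k => T.sim k
  | .inr .inp => T.inp
  | .inr .rev => T.rev
  | .inr (.buf b) => T.buf b
  | .inr .out => T.out
  | .inr (.clk i b) => List.replicate (T.clk i b) ()

/-- The stacks when all of them are empty. -/
def empty (M : TM2ComputableAux β γ) (d : ℕ) : Stacks M d :=
  ⟨fun _ => [], [], [], fun _ => [], [], fun _ _ => 0⟩

theorem contents_empty : (empty M d).contents = fun _ => [] := by
  funext k
  rcases k with k | _ | _ | _ | _ | _ <;> rfl

theorem length_contents_le {T : Stacks M d} {N : ℕ} (hsim : ∀ k, (T.sim k).length ≤ N)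
    (hinp : T.inp.length ≤ N) (hrev : T.rev.length ≤ N) (hbuf : ∀ b, (T.buf b).length ≤ N)
    (hout : T.out.length ≤ N) (hclk : ∀ i b, T.clk i b ≤ N) (k : M.tm.K ⊕ Stack d) :
    (T.contents k).length ≤ N := by
  rcases k with k | _ | _ | b | _ | ⟨i, b⟩
  · exact hsim k
  · exact hinp
  · exact hrev
  · exact hbuf b
  · exact hout
  · exact List.length_replicate.trans_le (hclk i b)

variable (T : Stacks M d)

theorem update_contents_sim (k : M.tm.K) (x : List (M.tm.Γ k)) :
    update T.contents (.inl k) x = { T with sim := update T.sim k x }.contents := by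
  refine Function.update_eq_iff.2 ⟨(Function.update_self k x T.sim).symm, ?_⟩
  rintro (k' | _ | _ | _ | _ | _) h
  · have hk : k' ≠ k := fun h' => h (h' ▸ rfl)
    exact (Function.update_of_ne hk x T.sim).symm
  all_goals rfl

theorem update_contents_inp (x : List β) :
    update T.contents (.inr .inp) x = { T with inp := x }.contents := by
  refine Function.update_eq_iff.2 ⟨rfl, ?_⟩
  rintro (k' | _ | _ | _ | _ | _) h <;> first | rfl | exact absurd rfl h

theorem update_contents_rev (x : List β) :
    update T.contents (.inr .rev) x = { T with rev := x }.contents := by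
  refine Function.update_eq_iff.2 ⟨rfl, ?_⟩
  rintro (k' | _ | _ | _ | _ | _) h <;> first | rfl | exact absurd rfl h

theorem update_contents_buf (b : Bool) (x : List (γ ⊕ β)) :
    update T.contents (.inr (.buf b)) x = { T with buf := update T.buf b x }.contents := by
  refine Function.update_eq_iff.2 ⟨(Function.update_self b x T.buf).symm, ?_⟩
  rintro (k' | _ | _ | b' | _ | _) h <;> try rfl
  have hb : b' ≠ b := fun h' => h (h' ▸ rfl)
  exact (Function.update_of_ne hb x T.buf).symm

theorem update_contents_out (x : List (Bool ⊕ (γ ⊕ β))) :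
    update T.contents (.inr .out) x = { T with out := x }.contents := by
  refine Function.update_eq_iff.2 ⟨rfl, ?_⟩
  rintro (k' | _ | _ | _ | _ | _) h <;> first | rfl | exact absurd rfl h

theorem update_contents_clk (i : Fin d) (b : Bool) (x : List Unit) :
    update T.contents (.inr (.clk i b)) x =
      { T with clk := update T.clk i (update (T.clk i) b x.length) }.contents := by
  refine Function.update_eq_iff.2 ⟨?_, ?_⟩
  · simp only [contents, Function.update_self]
    exact List.eq_replicate_of_mem fun _ _ => rfl
  · rintro (k' | _ | _ | _ | _ | ⟨j, c⟩) h <;> try rfl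
    by_cases hj : j = i
    · subst hj
      have hc : c ≠ b := fun h' => h (h' ▸ rfl)
      simp only [contents, Function.update_self, Function.update_of_ne hc]
    · simp only [contents, Function.update_of_ne hj]

end Stacks

/-- Moves a token from pile `b` of digit `i` to its other pile and continues with `q₁`. If there is
no such token, the piles swap their roles instead and `q₂` is next. -/
def tickDigit (i : Fin d) (b : Bool) (q₁ q₂ : Stmt M d) : Stmt M d :=
  .pop (.inr (.clk i b)) (fun v o => { v with flag := o.isSome }) <|
  .branch State.flag
    (.push (.inr (.clk i !b)) (fun _ => ()) <| .load (fun v => { v with flag := false }) q₁)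
    (.load (fun v => { v with dir := update v.dir i !b, flag := false }) q₂)

/-- Turns back the clock with digits `is` by one and continues with `q₁`, or with `q₂` if the clock
has run out. -/
def tick (q₁ q₂ : Stmt M d) : List (Fin d) → Stmt M d
  | [] => q₂
  | i :: is =>
    .branch (fun v => v.dir i) (tickDigit i true q₁ (tick q₁ q₂ is))
      (tickDigit i false q₁ (tick q₁ q₂ is))

theorem stepAux_tickDigit (q₁ q₂ : Stmt M d) (i : Fin d) (C : Clock d) (s : M.tm.σ)
    (x : Option (γ ⊕ β)) (T : Stacks M d) :
    TM2.stepAux (tickDigit i (C.dir i) q₁ q₂) ⟨s, C.dir, x, false⟩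
        { T with clk := C.count }.contents =
      if C.count i (C.dir i) = 0 then
        TM2.stepAux q₂ ⟨s, (C.flip i).dir, x, false⟩ { T with clk := (C.flip i).count }.contents
      else TM2.stepAux q₁ ⟨s, (C.moveToken i).dir, x, false⟩
        { T with clk := (C.moveToken i).count }.contents := by
  split_ifs with h
  · have hnil : update C.count i (update (C.count i) (C.dir i) 0) = C.count := by
      rw [← h, Function.update_eq_self, Function.update_eq_self]
    simp [tickDigit, Stacks.contents, Stacks.update_contents_clk, h, Clock.flip, hnil]
  · have hhead : (List.replicate (C.count i (C.dir i)) ()).head?.isSome = true := by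
      simp [List.head?_replicate, h]
    simp [tickDigit, Stacks.contents, Stacks.update_contents_clk, hhead, Clock.moveToken]

theorem stepAux_tick (q₁ q₂ : Stmt M d) (is : List (Fin d)) (C : Clock d) (s : M.tm.σ)
    (x : Option (γ ⊕ β)) (T : Stacks M d) :
    TM2.stepAux (tick q₁ q₂ is) ⟨s, C.dir, x, false⟩ { T with clk := C.count }.contents =
      TM2.stepAux (bif (C.advance is).1 then q₁ else q₂) ⟨s, (C.advance is).2.dir, x, false⟩
        { T with clk := (C.advance is).2.count }.contents := by
  induction is generalizing C with
  | nil => rfl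
  | cons i is ih =>
    have hbranch : TM2.stepAux (tick q₁ q₂ (i :: is)) ⟨s, C.dir, x, false⟩
          { T with clk := C.count }.contents =
        TM2.stepAux (tickDigit i (C.dir i) q₁ (tick q₁ q₂ is)) ⟨s, C.dir, x, false⟩
          { T with clk := C.count }.contents := by
      rw [tick, TM2.stepAux]
      cases h : C.dir i <;> simp [h]
    rw [hbranch, stepAux_tickDigit, Clock.advance]
    split_ifs
    · exact ih (C.flip i)
    · rfl

/-- Puts a token on the first pile of each digit in `is` and continues with `q`. -/
def pushTokens (q : Stmt M d) : List (Fin d) → Stmt M d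
  | [] => q
  | i :: is => .push (.inr (.clk i true)) (fun _ => ()) (pushTokens q is)

theorem stepAux_pushTokens (q : Stmt M d) {is : List (Fin d)} (his : is.Nodup)
    (v : State M.tm.σ β γ d) (T : Stacks M d) :
    TM2.stepAux (pushTokens q is) v T.contents =
      TM2.stepAux q v { T with
        clk := fun i b => if i ∈ is ∧ b = true then T.clk i b + 1 else T.clk i b }.contents := by
  induction is generalizing T with
  | nil => simp [pushTokens]
  | cons i is ih =>
    obtain ⟨hi, his⟩ := List.nodup_cons.1 his
    rw [pushTokens, TM2.stepAux, Stacks.update_contents_clk, ih his]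
    congr 2
    simp only [Stacks.mk.injEq, true_and]
    funext j b
    by_cases hj : j = i
    · subst hj
      cases b <;> simp [hi, Stacks.contents]
    · simp [hj]

/-- The embedding of `M` into the machine that runs it with a clock. -/
def embedding (M : TM2ComputableAux β γ) (d : ℕ) :
    ProgramEmbedding M.tm.K (M.tm.K ⊕ Stack d) M.tm.Λ (Label M.tm.Λ) M.tm.σ
      (State M.tm.σ β γ d) where
  stack := .inl
  label := .sim
  exit := some .collect
  get := State.inner
  set s v := { v with inner := s }

/-- The frame of a run of `M` with a clock that has the directions `dir`. -/
def frame (T : Stacks M d) (dir : Fin d → Bool) : (embedding M d).Frame (Alphabet M d) where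
  state s := ⟨s, dir, none, false⟩
  stk S := { T with sim := S }.contents
  get_state _ := rfl
  set_state _ _ := rfl
  stk_apply _ _ := rfl
  update_stk _ _ _ := Stacks.update_contents_sim _ _ _

/-- The flag of a state of a clocked machine. -/
def stateFlag (σ β γ : Type) (d : ℕ) : StateFlag (State σ β γ d) where
  get := State.flag
  set b v := { v with flag := b }
  get_set _ _ := rfl

/-- The stacks that are emptied before the buffer `b` is output. -/
noncomputable def drained (M : TM2ComputableAux β γ) (d : ℕ) (b : Bool) :
    List (M.tm.K ⊕ Stack d) :=
  letI := M.tm.kFin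
  (Finset.univ.erase (.inr (.buf b))).toList

theorem mem_drained {b : Bool} {k : M.tm.K ⊕ Stack d} :
    k ∈ drained M d b ↔ k ≠ .inr (.buf b) := by
  simp [drained]

theorem nodup_drained (M : TM2ComputableAux β γ) (d : ℕ) (b : Bool) : (drained M d b).Nodup :=
  Finset.nodup_toList _

section Program

variable [Inhabited β]

/-- The input symbol that was popped last. -/
def State.inputSymbol {σ : Type} (v : State σ β γ d) : β :=
  (v.sym.bind Sum.getRight?).getD default

/-- The symbol that was popped last. -/
def State.symbol {σ : Type} (v : State σ β γ d) : γ ⊕ β :=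
  v.sym.getD (.inr default)

/-- The state in which a clocked machine starts and halts. -/
def initialState (M : TM2ComputableAux β γ) (d : ℕ) : State M.tm.σ β γ d :=
  ⟨M.tm.initialState, fun _ => true, none, false⟩

/-- The program that runs `M` with a clock. It outputs the result of `M` with the tag `false`, or a
copy of the input with the tag `true` if the clock has run out before `M` halts. -/
noncomputable def program (M : TM2ComputableAux β γ) (d : ℕ) : Label M.tm.Λ → Stmt M d
  | .scan =>
    .pop (.inr .inp) (fun v o => { v with sym := o.map .inr }) <|
    .branch (fun v => v.sym.isSome)
      (.push (.inr .rev) State.inputSymbol <| .push (.inr (.buf true)) State.symbol <|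
        .goto fun _ => .scan)
      (.goto fun _ => .fill)
  | .fill =>
    .pop (.inr .rev) (fun v o => { v with sym := o.map .inr }) <|
    .branch (fun v => v.sym.isSome)
      (.push (.inl M.tm.k₀) (fun v => M.inputAlphabet.symm v.inputSymbol) <|
        pushTokens (.goto fun _ => .fill) (List.finRange d))
      (.goto fun _ => .sim M.tm.main)
  | .sim l => tick ((embedding M d).lift (M.tm.m l)) (.goto fun _ => .clean true) (List.finRange d)
  | .collect =>
    .pop (.inl M.tm.k₁) (fun v o => { v with sym := o.map fun y => .inl (M.outputAlphabet y) }) <|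
    .branch (fun v => v.sym.isSome)
      (.push (.inr (.buf false)) State.symbol <| .goto fun _ => .collect)
      (.goto fun _ => .clean false)
  | .clean b =>
    drain (stateFlag M.tm.σ β γ d) (initialState M d) (.clean b) (.emit b) (drained M d b)
  | .emit b =>
    .pop (.inr (.buf b)) (fun v o => { v with sym := o }) <|
    .branch (fun v => v.sym.isSome)
      (.push (.inr .out) (fun v => .inr v.symbol) <| .goto fun _ => .emit b)
      (.push (.inr .out) (fun _ => .inl b) .halt)

/-- One step of the machine that runs `M` with a clock. -/
noncomputable abbrev step (M : TM2ComputableAux β γ) (d : ℕ) : Cfg M d → Option (Cfg M d) :=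
  TM2.step (program M d)

theorem stepsTo_scan (w : List β) (x : Option (γ ⊕ β)) (T : Stacks M d) :
    StepsTo (step M d) (w.length + 1)
      ⟨some .scan, { initialState M d with sym := x }, { T with inp := w }.contents⟩
      ⟨some .fill, initialState M d, { T with
        inp := []
        rev := w.reverse ++ T.rev
        buf := update T.buf true (w.reverse.map Sum.inr ++ T.buf true) }.contents⟩ := by
  induction w generalizing T x with
  | nil =>
    refine .single ?_
    simp [TM2.step, program, Stacks.contents, Stacks.update_contents_inp, initialState]
  | cons a w ih =>
    refine .head (b := ⟨some .scan, { initialState M d with sym := some (.inr a) }, { T with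
      inp := w
      rev := a :: T.rev
      buf := update T.buf true (.inr a :: T.buf true) }.contents⟩) ?_ ?_
    · simp [TM2.step, program, Stacks.contents, Stacks.update_contents_inp,
        Stacks.update_contents_rev, Stacks.update_contents_buf, State.inputSymbol, State.symbol]
    · simpa using ih (some (.inr a))
        { T with rev := a :: T.rev, buf := update T.buf true (.inr a :: T.buf true) }

theorem stepsTo_fill (w : List β) (x : Option (γ ⊕ β)) (T : Stacks M d) (S : List (M.tm.Γ M.tm.k₀))
    (n : ℕ) :
    StepsTo (step M d) (w.length + 1)
      ⟨some .fill, { initialState M d with sym := x }, { T with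
        sim := update (fun _ => []) M.tm.k₀ S
        rev := w
        clk := fun _ b => bif b then n else 0 }.contents⟩
      ⟨some (.sim M.tm.main), initialState M d, { T with
        sim := update (fun _ => []) M.tm.k₀ (w.reverse.map M.inputAlphabet.symm ++ S)
        rev := []
        clk := fun _ b => bif b then n + w.length else 0 }.contents⟩ := by
  induction w generalizing x S n with
  | nil =>
    refine .single ?_
    simp [TM2.step, program, Stacks.contents, Stacks.update_contents_rev, initialState]
  | cons a w ih =>
    refine .head (b := ⟨some .fill, { initialState M d with sym := some (.inr a) }, { T with
      sim := update (fun _ => []) M.tm.k₀ (M.inputAlphabet.symm a :: S)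
      rev := w
      clk := fun _ b => bif b then n + 1 else 0 }.contents⟩) ?_ ?_
    · have hclk : (fun (i : Fin d) b => if b = true then (bif b then n else 0) + 1 else
          bif b then n else 0) = fun _ b => bif b then n + 1 else 0 := by
        funext _ b; cases b <;> rfl
      simp [TM2.step, program, Stacks.contents, Stacks.update_contents_rev,
        Stacks.update_contents_sim, stepAux_pushTokens _ (List.nodup_finRange d), State.inputSymbol,
        hclk]
    · simpa [add_assoc, add_comm, add_left_comm] using
        ih (some (.inr a)) (M.inputAlphabet.symm a :: S) (n + 1)

theorem stepsTo_emit (b : Bool) (z : List (γ ⊕ β)) (x : Option (γ ⊕ β)) (T : Stacks M d) :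
    StepsTo (step M d) (z.length + 1)
      ⟨some (.emit b), { initialState M d with sym := x },
        { T with buf := update T.buf b z }.contents⟩
      ⟨none, initialState M d, { T with
        buf := update T.buf b []
        out := .inl b :: (z.reverse.map Sum.inr ++ T.out) }.contents⟩ := by
  induction z generalizing T x with
  | nil =>
    refine .single ?_
    simp [TM2.step, program, Stacks.contents, Stacks.update_contents_buf,
      Stacks.update_contents_out, initialState]
  | cons a z ih =>
    refine .head (b := ⟨some (.emit b), { initialState M d with sym := some a }, { T with
      buf := update T.buf b z
      out := .inr a :: T.out }.contents⟩) ?_ ?_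
    · simp [TM2.step, program, Stacks.contents, Stacks.update_contents_buf,
        Stacks.update_contents_out, State.symbol]
    · simpa using ih (some a) { T with out := .inr a :: T.out }

theorem stepsTo_collect (u : List γ) (x : Option (γ ⊕ β)) (dir : Fin d → Bool) (T : Stacks M d) :
    StepsTo (step M d) (u.length + 1)
      ⟨some .collect, { initialState M d with dir := dir, sym := x }, { T with
        sim := update T.sim M.tm.k₁ (u.map M.outputAlphabet.symm) }.contents⟩
      ⟨some (.clean false), { initialState M d with dir := dir }, { T with
        sim := update T.sim M.tm.k₁ []
        buf := update T.buf false (u.reverse.map Sum.inl ++ T.buf false) }.contents⟩ := by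
  induction u generalizing T x with
  | nil =>
    refine .single ?_
    simp [TM2.step, program, Stacks.contents, Stacks.update_contents_sim, initialState]
  | cons a u ih =>
    refine .head (b := ⟨some .collect, { initialState M d with dir := dir, sym := some (.inl a) },
      { T with
        sim := update T.sim M.tm.k₁ (u.map M.outputAlphabet.symm)
        buf := update T.buf false (.inl a :: T.buf false) }.contents⟩) ?_ ?_
    · simp [TM2.step, program, Stacks.contents, Stacks.update_contents_sim,
        Stacks.update_contents_buf, State.symbol]
    · simpa using ih (some (.inl a)) { T with buf := update T.buf false (.inl a :: T.buf false) }

/-- The configuration of the clocked machine when `M` has the configuration `a` and the clock the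
state `C`. -/
def simCfg (T : Stacks M d) (C : Clock d) (a : M.tm.Cfg) : Cfg M d :=
  (frame { T with clk := C.count } C.dir).cfg a

theorem step_simCfg_of_advance {C : Clock d} (h : (C.advance (List.finRange d)).1 = true)
    {a b : M.tm.Cfg} (hab : TM2.step M.tm.m a = some b) (T : Stacks M d) :
    step M d (simCfg T C a) = some (simCfg T (C.advance (List.finRange d)).2 b) := by
  obtain ⟨_ | l, s, S⟩ := a
  · cases hab
  · have htick := stepAux_tick ((embedding M d).lift (M.tm.m l)) (.goto fun _ => .clean true)
      (List.finRange d) C s none { T with sim := S }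
    rw [h, cond_true] at htick
    cases hab
    exact congrArg some (htick.trans (ProgramEmbedding.stepAux_lift
      (frame { T with clk := (C.advance (List.finRange d)).2.count } _) (M.tm.m l) s S))

theorem step_simCfg_of_not_advance {C : Clock d} (h : (C.advance (List.finRange d)).1 = false)
    (l : M.tm.Λ) (s : M.tm.σ) (S : ∀ k, List (M.tm.Γ k)) (T : Stacks M d) :
    step M d (simCfg T C ⟨some l, s, S⟩) = some ⟨some (.clean true),
      ⟨s, (C.advance (List.finRange d)).2.dir, none, false⟩,
      { T with sim := S, clk := (C.advance (List.finRange d)).2.count }.contents⟩ := by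
  have htick := stepAux_tick ((embedding M d).lift (M.tm.m l)) (.goto fun _ => .clean true)
    (List.finRange d) C s none { T with sim := S }
  rw [h, cond_false] at htick
  exact congrArg some htick

theorem exists_stepsTo_simCfg {n t : ℕ} {C : Clock d} (hC : C.Total n)
    (ht : t ≤ C.remaining n (List.finRange d)) {a b : M.tm.Cfg}
    (h : StepsTo (TM2.step M.tm.m) t a b) (T : Stacks M d) :
    ∃ C' : Clock d, C'.Total n ∧
      C'.remaining n (List.finRange d) + t = C.remaining n (List.finRange d) ∧
      StepsTo (step M d) t (simCfg T C a) (simCfg T C' b) := by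
  induction t generalizing b with
  | zero => exact ⟨C, hC, rfl, h.eq_of_zero ▸ .refl _⟩
  | succ t ih =>
    obtain ⟨e, hae, heb⟩ := h.exists_tail
    obtain ⟨C', hC', hrem, hsim⟩ := ih (by omega) hae
    have hadvance : (C'.advance (List.finRange d)).1 = true := by
      by_contra h0
      have := Clock.remaining_eq_zero_of_advance (n := n) (List.nodup_finRange d)
        (Bool.eq_false_iff.2 h0)
      omega
    refine ⟨_, hC'.advance _, ?_, hsim.tail (step_simCfg_of_advance hadvance heb T)⟩
    have := Clock.remaining_advance_add_one (List.nodup_finRange d) hC' hadvance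
    omega

theorem stepsWithin_clean (b : Bool) (v : State M.tm.σ β γ d) (T : Stacks M d) (N : ℕ)
    (hT : ∀ k, k ≠ .inr (.buf b) → (T.contents k).length ≤ N) :
    StepsWithin (step M d) (N + 1) ⟨some (.clean b), v, T.contents⟩
      ⟨some (.emit b), initialState M d, { Stacks.empty M d with
        buf := update (fun _ => []) b (T.buf b) }.contents⟩ := by
  have hbuf := (Stacks.empty M d).update_contents_buf b (T.buf b)
  rw [Stacks.contents_empty] at hbuf
  refine stepsWithin_drain (m := program M d) (l := .clean b) rfl (nodup_drained M d b)
    (fun k hk => hT k (mem_drained.1 hk)) (fun k hk => ?_) fun k hk => ?_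
  · exact (congrFun hbuf k).symm.trans (Function.update_of_ne (mem_drained.1 hk) _ _)
  · obtain rfl : k = .inr (.buf b) := by simpa [mem_drained] using hk
    simp [Stacks.contents]

theorem stepsWithin_output {b : Bool} (v : State M.tm.σ β γ d) {T : Stacks M d} {z : List (γ ⊕ β)}
    (hz : T.buf b = z.reverse) {N : ℕ} (hT : ∀ k, (T.contents k).length ≤ N) :
    StepsWithin (step M d) (2 * N + 2) ⟨some (.clean b), v, T.contents⟩
      ⟨none, initialState M d,
        { Stacks.empty M d with out := .inl b :: z.map Sum.inr }.contents⟩ := by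
  have hclean := stepsWithin_clean b v T N fun k _ => hT k
  have hemit := stepsTo_emit b (T.buf b) none (Stacks.empty M d)
  simp only [Stacks.empty, update_nil_nil, hz, List.reverse_reverse, List.append_nil]
    at hclean hemit ⊢
  have hlength : (T.buf b).length ≤ N := hT (.inr (.buf b))
  rw [hz] at hlength
  exact (hclean.trans hemit.within).mono (by omega)

/-- The stacks after the input `w` was read, apart from the stacks of `M` and the clock. -/
def loaded (M : TM2ComputableAux β γ) (d : ℕ) (w : List β) : Stacks M d :=
  { Stacks.empty M d with buf := update (fun _ => []) true (w.reverse.map .inr) }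

theorem stepsTo_start (w : List β) :
    StepsTo (step M d) (2 * (w.length + 1))
      ⟨some .scan, initialState M d, { Stacks.empty M d with inp := w }.contents⟩
      (simCfg (loaded M d w) (Clock.full d w.length) (startCfg M w)) := by
  have hscan := stepsTo_scan w none (Stacks.empty M d)
  have hfill := stepsTo_fill w.reverse none (loaded M d w) [] 0
  have hclk : (fun (_ : Fin d) b => bif b then 0 else 0) = fun _ _ => 0 := by
    funext _ b; cases b <;> rfl
  simp only [update_nil_nil, hclk, loaded, Stacks.empty, List.append_nil, List.length_reverse,
    List.reverse_reverse, List.map_reverse, zero_add] at hscan hfill ⊢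
  rw [two_mul]
  exact hscan.trans hfill

theorem stepsWithin_haltCfg (w : List β) (u : List γ) {C : Clock d} (hC : C.Total w.length) :
    StepsWithin (step M d) (2 * w.length + 3 * u.length + 3)
      (simCfg (loaded M d w) C (haltCfg M u))
      ⟨none, initialState M d, { Stacks.empty M d with out := tagged (.inl u) }.contents⟩ := by
  have hcollect := stepsTo_collect u none C.dir { loaded M d w with clk := C.count }
  have houtput := stepsWithin_output { initialState M d with dir := C.dir }
    (T := { loaded M d w with
      sim := update (fun _ => []) M.tm.k₁ []
      buf := update (loaded M d w).buf false
        (u.reverse.map Sum.inl ++ (loaded M d w).buf false)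
      clk := C.count }) (z := u.map Sum.inl) (b := false) (N := w.length + u.length)
    (by simp [loaded]) (Stacks.length_contents_le (by simp) (Nat.zero_le _)
      (Nat.zero_le _) (by simp [loaded]) (Nat.zero_le _)
      fun i b => (hC.count_le i b).trans (Nat.le_add_right _ _))
  simp only [List.map_map] at houtput
  exact (hcollect.within.trans houtput).mono (by omega)

theorem stepsWithin_of_le_remaining {w : List β} {u : List γ} {t : ℕ} (h : OutputsAfter M t w u)
    (ht : t ≤ (Clock.full d w.length).remaining w.length (List.finRange d)) :
    StepsWithin (step M d) (4 * w.length + 3 * u.length + t + 5)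
      ⟨some .scan, initialState M d, { Stacks.empty M d with inp := w }.contents⟩
      ⟨none, initialState M d, { Stacks.empty M d with out := tagged (.inl u) }.contents⟩ := by
  obtain ⟨C, hC, -, hsim⟩ := exists_stepsTo_simCfg Clock.total_full ht h (loaded M d w)
  exact (((stepsTo_start w).trans hsim).within.trans (stepsWithin_haltCfg w u hC)).mono (by omega)

theorem stepsWithin_of_remaining_lt {B : ℕ} (hB : IsGrowthBound M B) {w : List β} {u : List γ}
    {t R : ℕ} (h : OutputsAfter M t w u)
    (hR : (Clock.full d w.length).remaining w.length (List.finRange d) = R) (ht : R < t) :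
    StepsWithin (step M d) (4 * w.length + R + 2 * (R * B) + 5)
      ⟨some .scan, initialState M d, { Stacks.empty M d with inp := w }.contents⟩
      ⟨none, initialState M d, { Stacks.empty M d with out := tagged (.inr w) }.contents⟩ := by
  obtain ⟨r, rfl⟩ : ∃ r, t = R + (r + 1) := Nat.exists_eq_add_of_lt ht
  obtain ⟨a, hrun, hrest⟩ := h.exists_split
  obtain ⟨_, hstep, -⟩ := hrest.exists_head
  obtain ⟨C, hC, hrem, hsim⟩ := exists_stepsTo_simCfg Clock.total_full hR.ge hrun (loaded M d w)
  obtain ⟨_ | l, s, S⟩ := a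
  · cases hstep
  have hout : (C.advance (List.finRange d)).1 = false := by
    by_contra hadvance
    have := Clock.remaining_advance_add_one (List.nodup_finRange d) hC
      (Bool.eq_true_of_not_eq_false hadvance)
    omega
  have houtput := stepsWithin_output ⟨s, (C.advance (List.finRange d)).2.dir, none, false⟩
    (T := { loaded M d w with sim := S, clk := (C.advance (List.finRange d)).2.count })
    (z := w.map Sum.inr) (b := true) (N := w.length + R * B) (by simp [loaded])
    (Stacks.length_contents_le (hB w R _ hrun) (Nat.zero_le _) (Nat.zero_le _) (by simp [loaded])
      (Nat.zero_le _) fun i b => ((hC.advance _).count_le i b).trans (Nat.le_add_right _ _))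
  have hclean := hsim.tail (step_simCfg_of_not_advance hout l s S _)
  simp only [List.map_map] at houtput
  exact (((stepsTo_start w).trans hclean).within.trans houtput).mono (by omega)

end Program

variable [Finite β] [Finite γ] [Inhabited β]

/-- The machine that runs `M` for fewer than `(n + 1) ^ d` steps on an input of length `n`. -/
noncomputable def machine (M : TM2ComputableAux β γ) (d : ℕ) :
    TM2ComputableAux β (Bool ⊕ (γ ⊕ β)) :=
  letI := M.tm.kFin
  letI := M.tm.ΛFin
  letI := M.tm.σFin
  { tm :=
      { K := M.tm.K ⊕ Stack d
        k₀ := .inr .inp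
        k₁ := .inr .out
        Γ := Alphabet M d
        Λ := Label M.tm.Λ
        main := .scan
        σ := State M.tm.σ β γ d
        initialState := initialState M d
        σFin := Fintype.ofFinite _
        Γk₀Fin := Fintype.ofFinite β
        m := program M d }
    inputAlphabet := Equiv.refl β
    outputAlphabet := Equiv.refl (Bool ⊕ (γ ⊕ β)) }

theorem startCfg_machine (w : List β) :
    startCfg (machine M d) w =
      ⟨some .scan, initialState M d, { Stacks.empty M d with inp := w }.contents⟩ := by
  have h := (Stacks.empty M d).update_contents_inp w
  rw [Stacks.contents_empty] at h
  rw [← h]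
  change singleStackCfg (Γ := Alphabet M d) (some Label.scan) _ (Sum.inr Stack.inp) (w.map id) = _
  rw [List.map_id]
  rfl

theorem haltCfg_machine (z : List (Bool ⊕ (γ ⊕ β))) :
    haltCfg (machine M d) z =
      ⟨none, initialState M d, { Stacks.empty M d with out := z }.contents⟩ := by
  have h := (Stacks.empty M d).update_contents_out z
  rw [Stacks.contents_empty] at h
  rw [← h]
  change singleStackCfg (Γ := Alphabet M d) none _ (Sum.inr Stack.out) (z.map id) = _
  rw [List.map_id]
  rfl

theorem outputsWithin_machine {B : ℕ} (hB : IsGrowthBound M B) {w : List β} {u : List γ} {t : ℕ}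
    (h : OutputsAfter M t w u) :
    OutputsWithin (machine M d)
      (7 * w.length + (w.length + 1) ^ d + 3 * ((w.length + 1) ^ d * B) + 5) w
      (tagged (if t < (w.length + 1) ^ d then .inl u else .inr w)) := by
  rw [OutputsWithin, startCfg_machine, haltCfg_machine]
  have hfull := Clock.remaining_full_add_one (n := w.length) (List.finRange d)
  rw [List.length_finRange] at hfull
  split_ifs with ht
  · refine (stepsWithin_of_le_remaining h (by omega)).mono ?_
    have := hB.length_output_le h
    have := Nat.mul_le_mul_right B ht.le
    omega
  · refine (stepsWithin_of_remaining_lt hB h rfl (by omega)).mono ?_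
    have := Nat.mul_le_mul_right B (Nat.le_of_succ_le hfull.le)
    omega

end Clocked

theorem exists_clocked {β γ : Type} [Finite β] [Finite γ] [Inhabited β] (M : TM2ComputableAux β γ)
    (d : ℕ) :
    ∃ (N : TM2ComputableAux β (Bool ⊕ (γ ⊕ β))) (p : Polynomial ℕ), ∀ w u t,
      OutputsAfter M t w u → OutputsWithin N (p.eval w.length) w
        (tagged (if t < (w.length + 1) ^ d then .inl u else .inr w)) := by
  obtain ⟨B, hB⟩ := exists_isGrowthBound M
  refine ⟨Clocked.machine M d,
    7 * .X + (.X + 1) ^ d + 3 * ((.X + 1) ^ d * .C B) + 5, fun w u t h => ?_⟩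
  simpa using Clocked.outputsWithin_machine (d := d) hB h

namespace Handoff

/-- The labels of the machine that runs one machine and then possibly a second one. -/
inductive Label (Λ₁ Λ₂ : Type)
  | first (l : Λ₁)
  | tag
  | unload (b : Bool)
  | route (b : Bool)
  | second (l : Λ₂)
  deriving Fintype

/-- The states of the machine that runs one machine and then possibly a second one: the states of
these two machines and the last symbol that was popped. -/
structure State (σ₁ σ₂ γ δ : Type) where
  fst : σ₁
  snd : σ₂
  sym : Option (Bool ⊕ (γ ⊕ δ))

instance {σ₁ σ₂ γ δ : Type} [Finite σ₁] [Finite σ₂] [Finite γ] [Finite δ] :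
    Finite (State σ₁ σ₂ γ δ) :=
  Finite.of_injective (fun v => (v.fst, v.snd, v.sym)) fun v w h => by
    cases v; cases w; simpa using h

variable {β γ δ : Type} {M₁ : TM2ComputableAux β (Bool ⊕ (γ ⊕ δ))} {M₂ : TM2ComputableAux δ γ}

/-- The alphabets of the stacks of `M₁`, of those of `M₂`, and of one additional stack. -/
abbrev Alphabet (M₁ : TM2ComputableAux β (Bool ⊕ (γ ⊕ δ))) (M₂ : TM2ComputableAux δ γ) :
    M₁.tm.K ⊕ (M₂.tm.K ⊕ Unit) → Type
  | .inl k => M₁.tm.Γ k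
  | .inr (.inl k) => M₂.tm.Γ k
  | .inr (.inr _) => γ ⊕ δ

/-- The statements of the machine that runs `M₁` and then possibly `M₂`. -/
abbrev Stmt (M₁ : TM2ComputableAux β (Bool ⊕ (γ ⊕ δ))) (M₂ : TM2ComputableAux δ γ) : Type :=
  TM2.Stmt (Alphabet M₁ M₂) (Label M₁.tm.Λ M₂.tm.Λ) (State M₁.tm.σ M₂.tm.σ γ δ)

/-- The contents of the stacks of the machine that runs `M₁` and then possibly `M₂`. -/
structure Stacks (M₁ : TM2ComputableAux β (Bool ⊕ (γ ⊕ δ))) (M₂ : TM2ComputableAux δ γ) where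
  fst : ∀ k, List (M₁.tm.Γ k)
  snd : ∀ k, List (M₂.tm.Γ k)
  temp : List (γ ⊕ δ)

namespace Stacks

/-- The contents of a given stack. -/
def contents (T : Stacks M₁ M₂) : ∀ k, List (Alphabet M₁ M₂ k)
  | .inl k => T.fst k
  | .inr (.inl k) => T.snd k
  | .inr (.inr _) => T.temp

/-- The stacks when all of them are empty. -/
def empty (M₁ : TM2ComputableAux β (Bool ⊕ (γ ⊕ δ))) (M₂ : TM2ComputableAux δ γ) :
    Stacks M₁ M₂ :=
  ⟨fun _ => [], fun _ => [], []⟩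

theorem contents_empty : (empty M₁ M₂).contents = fun _ => [] := by
  funext k
  rcases k with k | k | _ <;> rfl

variable (T : Stacks M₁ M₂)

theorem update_contents_fst (k : M₁.tm.K) (x : List (M₁.tm.Γ k)) :
    update T.contents (.inl k) x = { T with fst := update T.fst k x }.contents := by
  refine Function.update_eq_iff.2 ⟨(Function.update_self k x T.fst).symm, ?_⟩
  rintro (k' | _ | _) h
  · have hk : k' ≠ k := fun h' => h (h' ▸ rfl)
    exact (Function.update_of_ne hk x T.fst).symm
  all_goals rfl

theorem update_contents_snd (k : M₂.tm.K) (x : List (M₂.tm.Γ k)) :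
    update T.contents (.inr (.inl k)) x = { T with snd := update T.snd k x }.contents := by
  refine Function.update_eq_iff.2 ⟨(Function.update_self k x T.snd).symm, ?_⟩
  rintro (_ | k' | _) h
  · rfl
  · have hk : k' ≠ k := fun h' => h (h' ▸ rfl)
    exact (Function.update_of_ne hk x T.snd).symm
  · rfl

theorem update_contents_temp (x : List (γ ⊕ δ)) :
    update T.contents (.inr (.inr ())) x = { T with temp := x }.contents := by
  refine Function.update_eq_iff.2 ⟨rfl, ?_⟩
  rintro (_ | _ | _) h <;> first | rfl | exact absurd rfl h

end Stacks

/-- The embedding of `M₁`. -/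
def fstEmbedding (M₁ : TM2ComputableAux β (Bool ⊕ (γ ⊕ δ))) (M₂ : TM2ComputableAux δ γ) :
    ProgramEmbedding M₁.tm.K (M₁.tm.K ⊕ (M₂.tm.K ⊕ Unit)) M₁.tm.Λ (Label M₁.tm.Λ M₂.tm.Λ) M₁.tm.σ
      (State M₁.tm.σ M₂.tm.σ γ δ) where
  stack := .inl
  label := .first
  exit := some .tag
  get := State.fst
  set s v := { v with fst := s }

/-- The embedding of `M₂`. -/
def sndEmbedding (M₁ : TM2ComputableAux β (Bool ⊕ (γ ⊕ δ))) (M₂ : TM2ComputableAux δ γ) :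
    ProgramEmbedding M₂.tm.K (M₁.tm.K ⊕ (M₂.tm.K ⊕ Unit)) M₂.tm.Λ (Label M₁.tm.Λ M₂.tm.Λ) M₂.tm.σ
      (State M₁.tm.σ M₂.tm.σ γ δ) where
  stack k := .inr (.inl k)
  label := .second
  exit := none
  get := State.snd
  set s v := { v with snd := s }

/-- The frame of a run of `M₁`. -/
def fstFrame (M₁ : TM2ComputableAux β (Bool ⊕ (γ ⊕ δ))) (M₂ : TM2ComputableAux δ γ) :
    (fstEmbedding M₁ M₂).Frame (Alphabet M₁ M₂) where
  state s := ⟨s, M₂.tm.initialState, none⟩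
  stk S := { Stacks.empty M₁ M₂ with fst := S }.contents
  get_state _ := rfl
  set_state _ _ := rfl
  stk_apply _ _ := rfl
  update_stk _ _ _ := Stacks.update_contents_fst _ _ _

/-- The frame of a run of `M₂`. -/
def sndFrame (M₁ : TM2ComputableAux β (Bool ⊕ (γ ⊕ δ))) (M₂ : TM2ComputableAux δ γ) :
    (sndEmbedding M₁ M₂).Frame (Alphabet M₁ M₂) where
  state s := ⟨M₁.tm.initialState, s, none⟩
  stk S := { Stacks.empty M₁ M₂ with snd := S }.contents
  get_state _ := rfl
  set_state _ _ := rfl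
  stk_apply _ _ := rfl
  update_stk _ _ _ := Stacks.update_contents_snd _ _ _

/-- The state in which the machine starts and halts. -/
def initialState (M₁ : TM2ComputableAux β (Bool ⊕ (γ ⊕ δ))) (M₂ : TM2ComputableAux δ γ) :
    State M₁.tm.σ M₂.tm.σ γ δ :=
  ⟨M₁.tm.initialState, M₂.tm.initialState, none⟩

section Program

variable [Inhabited γ] [Inhabited δ]

/-- The symbol of the output of `M₁` that was popped last. -/
def State.symbol {σ₁ σ₂ : Type} (v : State σ₁ σ₂ γ δ) : γ ⊕ δ :=
  (v.sym.bind Sum.getRight?).getD (.inl default)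

/-- The symbol of the output of `M₁` that was popped last, as a symbol of `γ`. -/
def State.leftSymbol {σ₁ σ₂ : Type} (v : State σ₁ σ₂ γ δ) : γ :=
  v.symbol.getLeft?.getD default

/-- The symbol of the output of `M₁` that was popped last, as a symbol of `δ`. -/
def State.rightSymbol {σ₁ σ₂ : Type} (v : State σ₁ σ₂ γ δ) : δ :=
  v.symbol.getRight?.getD default

/-- The label after the tag was popped. -/
def State.unloadLabel {σ₁ σ₂ Λ₁ Λ₂ : Type} (v : State σ₁ σ₂ γ δ) : Label Λ₁ Λ₂ :=
  .unload ((v.sym.bind Sum.getLeft?).getD false)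

/-- The program that runs `M₁`. If the output of `M₁` has the tag `false`, it is the output without
the tag. Otherwise `M₂` is run on it. -/
def program (M₁ : TM2ComputableAux β (Bool ⊕ (γ ⊕ δ))) (M₂ : TM2ComputableAux δ γ) :
    Label M₁.tm.Λ M₂.tm.Λ → Stmt M₁ M₂
  | .first l => (fstEmbedding M₁ M₂).lift (M₁.tm.m l)
  | .tag =>
    .pop (.inl M₁.tm.k₁) (fun v o => { v with sym := o.map M₁.outputAlphabet }) <|
    .goto State.unloadLabel
  | .unload b =>
    .pop (.inl M₁.tm.k₁) (fun v o => { v with sym := o.map M₁.outputAlphabet }) <|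
    .branch (fun v => v.sym.isSome)
      (.push (.inr (.inr ())) State.symbol <| .goto fun _ => .unload b)
      (.goto fun _ => .route b)
  | .route b =>
    .pop (.inr (.inr ())) (fun v o => { v with sym := o.map .inr }) <|
    .branch (fun v => v.sym.isSome)
      (bif b then
        .push (.inr (.inl M₂.tm.k₀)) (fun v => M₂.inputAlphabet.symm v.rightSymbol) <|
          .goto fun _ => .route b
      else
        .push (.inr (.inl M₂.tm.k₁)) (fun v => M₂.outputAlphabet.symm v.leftSymbol) <|
          .goto fun _ => .route b)
      (bif b then .goto fun _ => .second M₂.tm.main else .halt)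
  | .second l => (sndEmbedding M₁ M₂).lift (M₂.tm.m l)

/-- One step of the machine that runs `M₁` and then possibly `M₂`. -/
abbrev step (M₁ : TM2ComputableAux β (Bool ⊕ (γ ⊕ δ))) (M₂ : TM2ComputableAux δ γ) :=
  TM2.step (program M₁ M₂)

theorem stepsTo_unload (b : Bool) (z : List (γ ⊕ δ)) (x : Option (Bool ⊕ (γ ⊕ δ)))
    (y : List (γ ⊕ δ)) :
    StepsTo (step M₁ M₂) (z.length + 1)
      ⟨some (.unload b), { initialState M₁ M₂ with sym := x },
        { Stacks.empty M₁ M₂ with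
          fst := update (fun _ => []) M₁.tm.k₁ (z.map fun s => M₁.outputAlphabet.symm (.inr s))
          temp := y }.contents⟩
      ⟨some (.route b), initialState M₁ M₂,
        { Stacks.empty M₁ M₂ with temp := z.reverse ++ y }.contents⟩ := by
  induction z generalizing x y with
  | nil =>
    refine .single ?_
    simp [TM2.step, program, Stacks.contents, Stacks.update_contents_fst, initialState,
      Stacks.empty]
  | cons a z ih =>
    refine .head (b := ⟨some (.unload b), { initialState M₁ M₂ with sym := some (.inr a) },
      { Stacks.empty M₁ M₂ with
        fst := update (fun _ => []) M₁.tm.k₁ (z.map fun s => M₁.outputAlphabet.symm (.inr s))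
        temp := a :: y }.contents⟩) ?_ ?_
    · simp [TM2.step, program, Stacks.contents, Stacks.update_contents_fst,
        Stacks.update_contents_temp, State.symbol]
    · simpa using ih (some (.inr a)) (a :: y)

theorem stepsTo_tag_unload (b : Bool) (z : List (γ ⊕ δ)) :
    StepsTo (step M₁ M₂) (z.length + 2)
      ⟨some .tag, initialState M₁ M₂, { Stacks.empty M₁ M₂ with
          fst := update (fun _ => []) M₁.tm.k₁ (M₁.outputAlphabet.symm (.inl b) ::
            z.map fun s => M₁.outputAlphabet.symm (.inr s)) }.contents⟩
      ⟨some (.route b), initialState M₁ M₂,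
        { Stacks.empty M₁ M₂ with temp := z.reverse }.contents⟩ := by
  have hunload := stepsTo_unload (M₁ := M₁) (M₂ := M₂) b z (some (.inl b)) []
  rw [List.append_nil] at hunload
  refine .head ?_ hunload
  simp [TM2.step, program, Stacks.contents, Stacks.update_contents_fst, State.unloadLabel,
    Stacks.empty]

theorem stepsTo_route_false (u : List γ) (x : Option (Bool ⊕ (γ ⊕ δ)))
    (y : List (M₂.tm.Γ M₂.tm.k₁)) :
    StepsTo (step M₁ M₂) (u.length + 1)
      ⟨some (.route false), { initialState M₁ M₂ with sym := x },
        { Stacks.empty M₁ M₂ with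
          snd := update (fun _ => []) M₂.tm.k₁ y
          temp := u.map Sum.inl }.contents⟩
      ⟨none, initialState M₁ M₂, { Stacks.empty M₁ M₂ with
        snd := update (fun _ => []) M₂.tm.k₁
          (u.reverse.map M₂.outputAlphabet.symm ++ y) }.contents⟩ := by
  induction u generalizing x y with
  | nil =>
    refine .single ?_
    simp [TM2.step, program, Stacks.contents, Stacks.update_contents_temp, initialState,
      Stacks.empty]
  | cons a u ih =>
    refine .head (b := ⟨some (.route false),
      { initialState M₁ M₂ with sym := some (.inr (.inl a)) },
      { Stacks.empty M₁ M₂ with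
        snd := update (fun _ => []) M₂.tm.k₁ (M₂.outputAlphabet.symm a :: y)
        temp := u.map Sum.inl }.contents⟩) ?_ ?_
    · simp [TM2.step, program, Stacks.contents, Stacks.update_contents_snd,
        Stacks.update_contents_temp, State.symbol, State.leftSymbol]
    · simpa using ih (some (.inr (.inl a))) (M₂.outputAlphabet.symm a :: y)

theorem stepsTo_route_true (z : List δ) (x : Option (Bool ⊕ (γ ⊕ δ)))
    (y : List (M₂.tm.Γ M₂.tm.k₀)) :
    StepsTo (step M₁ M₂) (z.length + 1)
      ⟨some (.route true), { initialState M₁ M₂ with sym := x },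
        { Stacks.empty M₁ M₂ with
          snd := update (fun _ => []) M₂.tm.k₀ y
          temp := z.map Sum.inr }.contents⟩
      ⟨some (.second M₂.tm.main), initialState M₁ M₂, { Stacks.empty M₁ M₂ with
        snd := update (fun _ => []) M₂.tm.k₀
          (z.reverse.map M₂.inputAlphabet.symm ++ y) }.contents⟩ := by
  induction z generalizing x y with
  | nil =>
    refine .single ?_
    simp [TM2.step, program, Stacks.contents, Stacks.update_contents_temp, initialState,
      Stacks.empty]
  | cons a z ih =>
    refine .head (b := ⟨some (.route true),
      { initialState M₁ M₂ with sym := some (.inr (.inr a)) },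
      { Stacks.empty M₁ M₂ with
        snd := update (fun _ => []) M₂.tm.k₀ (M₂.inputAlphabet.symm a :: y)
        temp := z.map Sum.inr }.contents⟩) ?_ ?_
    · simp [TM2.step, program, Stacks.contents, Stacks.update_contents_snd,
        Stacks.update_contents_temp, State.symbol, State.rightSymbol]
    · simpa using ih (some (.inr (.inr a))) (M₂.inputAlphabet.symm a :: y)

theorem stepsTo_unloaded {t : ℕ} {w : List β} {b : Bool} {z : List (γ ⊕ δ)}
    (h : OutputsAfter M₁ t w (.inl b :: z.map Sum.inr)) :
    StepsTo (step M₁ M₂) (t + (z.length + 2)) ((fstFrame M₁ M₂).cfg (startCfg M₁ w))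
      ⟨some (.route b), initialState M₁ M₂,
        { Stacks.empty M₁ M₂ with temp := z.reverse }.contents⟩ := by
  have hfst := ProgramEmbedding.stepsTo_cfg (m' := program M₁ M₂) (fstFrame M₁ M₂) (fun _ => rfl) h
  refine hfst.trans ?_
  rw [haltCfg, List.map_cons, List.map_map]
  exact stepsTo_tag_unload b z

theorem stepsTo_output_left {t : ℕ} {w : List β} {u : List γ}
    (h : OutputsAfter M₁ t w (tagged (.inl u))) :
    StepsTo (step M₁ M₂) (t + (u.length + 2) + (u.length + 1))
      ((fstFrame M₁ M₂).cfg (startCfg M₁ w)) ((sndFrame M₁ M₂).cfg (haltCfg M₂ u)) := by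
  have hunload := stepsTo_unloaded (M₂ := M₂) (z := u.map Sum.inl) (by rwa [List.map_map])
  have hroute := stepsTo_route_false (M₁ := M₁) (M₂ := M₂) u.reverse none []
  rw [← List.map_reverse, List.length_map] at hunload
  rw [update_nil_nil, List.reverse_reverse, List.append_nil, List.length_reverse] at hroute
  exact hunload.trans hroute

theorem stepsTo_output_right {t t' : ℕ} {w : List β} {z : List δ} {u : List γ}
    (h : OutputsAfter M₁ t w (tagged (.inr z))) (h' : OutputsAfter M₂ t' z u) :
    StepsTo (step M₁ M₂) (t + (z.length + 2) + (z.length + 1) + t')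
      ((fstFrame M₁ M₂).cfg (startCfg M₁ w)) ((sndFrame M₁ M₂).cfg (haltCfg M₂ u)) := by
  have hunload := stepsTo_unloaded (M₂ := M₂) (z := z.map Sum.inr) (by rwa [List.map_map])
  have hroute := stepsTo_route_true (M₁ := M₁) (M₂ := M₂) z.reverse none []
  rw [← List.map_reverse, List.length_map] at hunload
  rw [update_nil_nil, List.reverse_reverse, List.append_nil, List.length_reverse] at hroute
  exact (hunload.trans hroute).trans
    (ProgramEmbedding.stepsTo_cfg (m' := program M₁ M₂) (sndFrame M₁ M₂) (fun _ => rfl) h')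

end Program

variable [Finite γ] [Finite δ] [Inhabited γ] [Inhabited δ]

/-- The machine that runs `M₁` and, if the output of `M₁` has the tag `true`, then runs `M₂` on
this output. -/
noncomputable def machine (M₁ : TM2ComputableAux β (Bool ⊕ (γ ⊕ δ))) (M₂ : TM2ComputableAux δ γ) :
    TM2ComputableAux β γ :=
  letI := M₁.tm.kFin
  letI := M₂.tm.kFin
  letI := M₁.tm.ΛFin
  letI := M₂.tm.ΛFin
  letI := M₁.tm.σFin
  letI := M₂.tm.σFin
  { tm :=
      { K := M₁.tm.K ⊕ (M₂.tm.K ⊕ Unit)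
        k₀ := .inl M₁.tm.k₀
        k₁ := .inr (.inl M₂.tm.k₁)
        Γ := Alphabet M₁ M₂
        Λ := Label M₁.tm.Λ M₂.tm.Λ
        main := .first M₁.tm.main
        σ := State M₁.tm.σ M₂.tm.σ γ δ
        initialState := initialState M₁ M₂
        σFin := Fintype.ofFinite _
        Γk₀Fin := M₁.tm.Γk₀Fin
        m := program M₁ M₂ }
    inputAlphabet := M₁.inputAlphabet
    outputAlphabet := M₂.outputAlphabet }

theorem startCfg_machine (w : List β) :
    startCfg (machine M₁ M₂) w = (fstFrame M₁ M₂).cfg (startCfg M₁ w) := by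
  have h := (Stacks.empty M₁ M₂).update_contents_fst M₁.tm.k₀ (w.map M₁.inputAlphabet.symm)
  rw [Stacks.contents_empty] at h
  exact congrArg (TM2.Cfg.mk _ _) h

theorem haltCfg_machine (u : List γ) :
    haltCfg (machine M₁ M₂) u = (sndFrame M₁ M₂).cfg (haltCfg M₂ u) := by
  have h := (Stacks.empty M₁ M₂).update_contents_snd M₂.tm.k₁ (u.map M₂.outputAlphabet.symm)
  rw [Stacks.contents_empty] at h
  exact congrArg (TM2.Cfg.mk _ _) h

end Handoff

theorem exists_handoff {β γ δ : Type} [Finite γ] [Finite δ] [Inhabited γ] [Inhabited δ]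
    (M₁ : TM2ComputableAux β (Bool ⊕ (γ ⊕ δ))) (M₂ : TM2ComputableAux δ γ) (q : Polynomial ℕ) :
    ∃ (N : TM2ComputableAux β γ) (p : Polynomial ℕ), ∀ w,
      (∀ u, OutputsWithin M₁ (q.eval w.length) w (tagged (.inl u)) →
        OutputsWithin N (p.eval w.length) w u) ∧
      ∀ z u t, OutputsWithin M₁ (q.eval w.length) w (tagged (.inr z)) → OutputsWithin M₂ t z u →
        OutputsWithin N (p.eval w.length + t) w u := by
  obtain ⟨B, hB⟩ := exists_isGrowthBound M₁
  refine ⟨Handoff.machine M₁ M₂, q + 2 * (.X + q * .C B) + 1, fun w => ?_⟩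
  have hlen {n : ℕ} {v : List (Bool ⊕ (γ ⊕ δ))} (hn : n ≤ q.eval w.length)
      (h : OutputsAfter M₁ n w v) : v.length ≤ w.length + q.eval w.length * B :=
    (hB.length_output_le h).trans (by gcongr)
  simp only [OutputsWithin, Handoff.startCfg_machine, Handoff.haltCfg_machine, Polynomial.eval_add,
    Polynomial.eval_mul, Polynomial.eval_X, Polynomial.eval_C, Polynomial.eval_one,
    Polynomial.eval_ofNat]
  refine ⟨?_, ?_⟩
  · rintro u ⟨n, hn, h⟩
    have hout := hlen hn h
    refine (Handoff.stepsTo_output_left h).within.mono ?_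
    simp only [tagged, List.length_cons, List.length_map] at hout
    omega
  · rintro z u t ⟨n, hn, h⟩ ⟨n', hn', h'⟩
    have hout := hlen hn h
    refine (Handoff.stepsTo_output_right h h').within.mono ?_
    simp only [tagged, List.length_cons, List.length_map] at hout
    omega

theorem primrec₂_of_finite_left {ι α σ : Type*} [Finite ι] [Primcodable ι] [Primcodable α]
    [Primcodable σ] {f : ι → α → σ} (hf : ∀ i, Primrec (f i)) : Primrec₂ f := by
  obtain ⟨n, ⟨e⟩⟩ := Finite.exists_equiv_fin ι
  have hfin : Primrec₂ fun (j : Fin n) a => f (e.symm j) a :=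
    Primrec.fin_curry₁.2 fun j => hf (e.symm j)
  exact (hfin.comp ((Primrec.dom_finite e).comp Primrec.fst) Primrec.snd).of_eq fun p => by simp

theorem primrec_update_fin {α σ : Type*} [Primcodable α] [Primcodable σ] {n : ℕ}
    {f : α → Fin n → σ} {g : α → σ} (hf : Primrec f) (j : Fin n) (hg : Primrec g) :
    Primrec fun a => update (f a) j (g a) := by
  have hite : Primrec₂ fun (a : α) (i : Fin n) => if i = j then g a else f a i :=
    Primrec.ite (Primrec.eq.comp Primrec.snd (Primrec.const j)) (hg.comp Primrec.fst)
      (Primrec.fin_curry.1 hf)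
  exact Primrec.fin_curry.2 (hite.of_eq fun a i => by simp [Function.update_apply])

section Pushed

variable {K : Type*} {Γ : K → Type*} {Λ σ : Type*}

/-- The symbols that a statement may push. -/
def pushedSymbols : TM2.Stmt Γ Λ σ → Set (Σ k, Γ k)
  | .push k f q => (Set.range fun v => ⟨k, f v⟩) ∪ pushedSymbols q
  | .peek _ _ q => pushedSymbols q
  | .pop _ _ q => pushedSymbols q
  | .load _ q => pushedSymbols q
  | .branch _ q₁ q₂ => pushedSymbols q₁ ∪ pushedSymbols q₂
  | .goto _ => ∅
  | .halt => ∅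

theorem finite_pushedSymbols [Finite σ] (q : TM2.Stmt Γ Λ σ) : (pushedSymbols q).Finite := by
  induction q with
  | push _ _ _ ih => exact (Set.finite_range _).union ih
  | peek _ _ _ ih => exact ih
  | pop _ _ _ ih => exact ih
  | load _ _ ih => exact ih
  | branch _ _ _ ih₁ ih₂ => exact ih₁.union ih₂
  | goto _ => exact Set.finite_empty
  | halt => exact Set.finite_empty

end Pushed

/-- A coding of the stacks of a machine by `n` lists over the single alphabet `D`. The alphabets
`Γ k` may be infinite, hence `read` need not recover every symbol from its code. -/
structure StackCode {K : Type*} (Γ : K → Type*) (n : ℕ) (D : Type*) where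
  index : K → Fin n
  index_injective : Function.Injective index
  write (k : K) : Γ k → D
  read (k : K) : D → Option (Γ k)

namespace StackCode

variable {K : Type*} {Γ : K → Type*} {Λ σ : Type*} {n : ℕ} {D : Type*}

/-- The symbols that are recovered from their codes. -/
def readable (C : StackCode Γ n D) : Set (Σ k, Γ k) :=
  {s | C.read s.1 (C.write s.1 s.2) = some s.2}

theorem exists_subset_readable [Finite K] {U : Set (Σ k, Γ k)} (hU : U.Finite) :
    ∃ (n m : ℕ) (C : StackCode Γ n (Fin m)), U ⊆ C.readable := by
  classical
  have := hU.to_subtype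
  obtain ⟨n, ⟨e⟩⟩ := Finite.exists_equiv_fin K
  obtain ⟨m, ⟨d⟩⟩ := Finite.exists_equiv_fin (Option U)
  let write (k : K) (x : Γ k) : Fin m := d (if h : ⟨k, x⟩ ∈ U then some ⟨⟨k, x⟩, h⟩ else none)
  let read (k : K) (c : Fin m) : Option (Γ k) :=
    (d.symm c).bind fun u => if h : u.1.1 = k then some (h ▸ u.1.2) else none
  refine ⟨n, m, ⟨e, e.injective, write, read⟩, ?_⟩
  rintro ⟨k, x⟩ h
  simp [readable, write, read, h]

variable (C : StackCode Γ n D)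

/-- The effect of a statement on the state and the coded stacks, and the label to which it jumps. -/
def stepAux : TM2.Stmt Γ Λ σ → σ × (Fin n → List D) → Option Λ × σ × (Fin n → List D)
  | .push k f q, c =>
    stepAux q (c.1, update c.2 (C.index k) (C.write k (f c.1) :: c.2 (C.index k)))
  | .peek k f q, c => stepAux q (f c.1 ((c.2 (C.index k)).head?.bind (C.read k)), c.2)
  | .pop k f q, c =>
    stepAux q (f c.1 ((c.2 (C.index k)).head?.bind (C.read k)),
      update c.2 (C.index k) (c.2 (C.index k)).tail)
  | .load f q, c => stepAux q (f c.1, c.2)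
  | .branch f q₁ q₂, c => bif f c.1 then stepAux q₁ c else stepAux q₂ c
  | .goto f, c => (some (f c.1), c)
  | .halt, c => (none, c)

/-- One step on configurations with coded stacks. Unlike for `TM2.step`, halting configurations are
fixed points, which makes the function total. -/
def step (m : Λ → TM2.Stmt Γ Λ σ) (c : Option Λ × σ × (Fin n → List D)) :
    Option Λ × σ × (Fin n → List D) :=
  c.1.casesOn c fun l => C.stepAux (m l) c.2

/-- The lists `S'` code the stacks `S`, which contain only readable symbols. -/
def Encodes (S : ∀ k, List (Γ k)) (S' : Fin n → List D) : Prop :=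
  ∀ k, S' (C.index k) = (S k).map (C.write k) ∧ ∀ x ∈ S k, ⟨k, x⟩ ∈ C.readable

variable {C} {S : ∀ k, List (Γ k)} {S' : Fin n → List D}

theorem encodes_nil : C.Encodes (fun _ => []) fun _ => [] :=
  fun _ => ⟨rfl, fun _ hx => absurd hx List.not_mem_nil⟩

theorem Encodes.update [DecidableEq K] (h : C.Encodes S S') {k : K} {s : List (Γ k)}
    (hs : ∀ x ∈ s, ⟨k, x⟩ ∈ C.readable) :
    C.Encodes (update S k s) (update S' (C.index k) (s.map (C.write k))) := by
  intro k'
  by_cases hk : k' = k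
  · subst hk
    simpa using hs
  · simpa [hk, C.index_injective.ne hk] using h k'

theorem Encodes.update_cons [DecidableEq K] (h : C.Encodes S S') {k : K} {a : Γ k}
    (ha : ⟨k, a⟩ ∈ C.readable) :
    C.Encodes (Function.update S k (a :: S k))
      (Function.update S' (C.index k) (C.write k a :: S' (C.index k))) := by
  rw [(h k).1, ← List.map_cons]
  exact h.update (List.forall_mem_cons.2 ⟨ha, (h k).2⟩)

theorem Encodes.update_tail [DecidableEq K] (h : C.Encodes S S') (k : K) :
    C.Encodes (Function.update S k (S k).tail)
      (Function.update S' (C.index k) (S' (C.index k)).tail) := by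
  rw [(h k).1, ← List.map_tail]
  exact h.update fun x hx => (h k).2 x (List.mem_of_mem_tail hx)

theorem Encodes.head?_bind_read (h : C.Encodes S S') (k : K) :
    (S' (C.index k)).head?.bind (C.read k) = (S k).head? := by
  rw [(h k).1]
  cases hS : S k with
  | nil => rfl
  | cons a s => exact (h k).2 a (hS ▸ List.mem_cons_self)

/-- The configuration `c'` with coded stacks represents the configuration `c`. -/
structure Represents (C : StackCode Γ n D) (c : TM2.Cfg Γ Λ σ)
    (c' : Option Λ × σ × (Fin n → List D)) : Prop where
  label : c'.1 = c.l
  state : c'.2.1 = c.var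
  encodes : C.Encodes c.stk c'.2.2

theorem represents_stepAux [DecidableEq K] {q : TM2.Stmt Γ Λ σ} (hq : pushedSymbols q ⊆ C.readable)
    {v : σ} (h : C.Encodes S S') :
    C.Represents (TM2.stepAux q v S) (C.stepAux q (v, S')) := by
  induction q generalizing v S S' with
  | push k f q ih =>
    obtain ⟨hf, hq⟩ := Set.union_subset_iff.1 hq
    exact ih hq (h.update_cons (hf ⟨v, rfl⟩))
  | peek k f q ih =>
    simp only [stepAux, TM2.stepAux, h.head?_bind_read]
    exact ih hq h
  | pop k f q ih =>
    simp only [stepAux, TM2.stepAux, h.head?_bind_read]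
    exact ih hq (h.update_tail k)
  | load f q ih => exact ih hq h
  | branch f q₁ q₂ ih₁ ih₂ =>
    obtain ⟨hq₁, hq₂⟩ := Set.union_subset_iff.1 hq
    simp only [stepAux, TM2.stepAux]
    cases f v
    · exact ih₂ hq₂ h
    · exact ih₁ hq₁ h
  | goto f => exact ⟨rfl, rfl, h⟩
  | halt => exact ⟨rfl, rfl, h⟩

theorem iterate_step_halted_iff [DecidableEq K] {m : Λ → TM2.Stmt Γ Λ σ}
    (hm : ∀ l, pushedSymbols (m l) ⊆ C.readable) {t : ℕ} {a b : TM2.Cfg Γ Λ σ}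
    (h : StepsTo (TM2.step m) t a b) (hb : b.l = none) {a' : Option Λ × σ × (Fin n → List D)}
    (ha : C.Represents a a') (j : ℕ) : ((C.step m)^[j] a').1 = none ↔ t ≤ j := by
  induction t generalizing a a' j with
  | zero =>
    obtain ⟨_, c⟩ := a'
    obtain rfl := ha.label.trans (h.eq_of_zero ▸ hb)
    simp [Function.iterate_fixed (show C.step m (none, c) = (none, c) from rfl)]
  | succ t ih =>
    obtain ⟨c, hc, h⟩ := h.exists_head
    obtain ⟨_ | l, v, S⟩ := a
    · cases hc
    obtain rfl : TM2.stepAux (m l) v S = c := Option.some.inj hc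
    obtain ⟨l', v', S'⟩ := a'
    obtain ⟨hl, hv, hS⟩ := ha
    obtain rfl : l' = some l := hl
    obtain rfl : v' = v := hv
    cases j with
    | zero => simp
    | succ j =>
      rw [Function.iterate_succ_apply, Nat.succ_le_succ_iff]
      exact ih h (represents_stepAux (hm l) hS) j

section Primrec

variable [Finite σ] [Finite D] [Primcodable σ] [Primcodable D] [Primcodable Λ]
  (C : StackCode Γ n D)

theorem primrec_stepAux (q : TM2.Stmt Γ Λ σ) : Primrec (C.stepAux q) := by
  have hstack (k : K) : Primrec fun c : σ × (Fin n → List D) => c.2 (C.index k) :=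
    Primrec.fin_app.comp Primrec.snd (Primrec.const _)
  have hread (k : K) (f : σ → Option (Γ k) → σ) : Primrec fun c : σ × (Fin n → List D) =>
      f c.1 ((c.2 (C.index k)).head?.bind (C.read k)) :=
    (Primrec.dom_finite fun p : σ × Option D => f p.1 (p.2.bind (C.read k))).comp
      (Primrec.fst.pair (Primrec.list_head?.comp (hstack k)))
  induction q with
  | push k f q ih =>
    exact ih.comp (Primrec.fst.pair (primrec_update_fin Primrec.snd (C.index k)
      (Primrec.list_cons.comp ((Primrec.dom_finite fun v => C.write k (f v)).comp Primrec.fst)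
        (hstack k))))
  | peek k f q ih => exact ih.comp ((hread k f).pair Primrec.snd)
  | pop k f q ih =>
    exact ih.comp ((hread k f).pair (primrec_update_fin Primrec.snd (C.index k)
      (Primrec.list_tail.comp (hstack k))))
  | load f q ih => exact ih.comp (((Primrec.dom_finite f).comp Primrec.fst).pair Primrec.snd)
  | branch f q₁ q₂ ih₁ ih₂ =>
    exact Primrec.cond ((Primrec.dom_finite f).comp Primrec.fst) ih₁ ih₂
  | goto f =>
    exact (Primrec.option_some.comp ((Primrec.dom_finite f).comp Primrec.fst)).pair Primrec.id
  | halt => exact (Primrec.const none).pair Primrec.id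

theorem primrec_step [Finite Λ] (m : Λ → TM2.Stmt Γ Λ σ) : Primrec (C.step m) := by
  have h : Primrec₂ fun l c => C.stepAux (m l) c :=
    primrec₂_of_finite_left fun l => C.primrec_stepAux (m l)
  exact Primrec.option_casesOn Primrec.fst Primrec.id
    (h.comp Primrec.snd (Primrec.snd.comp Primrec.fst)).to₂

end Primrec

end StackCode

section TimeBound

variable {β γ : Type}

/-- The symbols of a machine that occur in its inputs or that it may push. -/
def usedSymbols (M : TM2ComputableAux β γ) : Set (Σ k, M.tm.Γ k) :=
  (Set.range fun x => ⟨M.tm.k₀, M.inputAlphabet.symm x⟩) ∪ ⋃ l, pushedSymbols (M.tm.m l)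

theorem finite_usedSymbols [Finite β] (M : TM2ComputableAux β γ) : (usedSymbols M).Finite := by
  have := M.tm.ΛFin
  have := M.tm.σFin
  exact (Set.finite_range _).union (Set.finite_iUnion fun l => finite_pushedSymbols (M.tm.m l))

namespace StackCode

variable {n : ℕ} {D : Type*} {M : TM2ComputableAux β γ} (C : StackCode M.tm.Γ n D)

/-- The coded configuration in which `M` starts on the word `w`. -/
def start (w : List β) : Option M.tm.Λ × M.tm.σ × (Fin n → List D) :=
  (some M.tm.main, M.tm.initialState,
    update (fun _ => []) (C.index M.tm.k₀)
      (w.map fun x => C.write M.tm.k₀ (M.inputAlphabet.symm x)))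

theorem represents_start (hC : usedSymbols M ⊆ C.readable) (w : List β) :
    C.Represents (startCfg M w) (C.start w) := by
  have hmem : ∀ x ∈ w.map M.inputAlphabet.symm, ⟨M.tm.k₀, x⟩ ∈ C.readable := by
    intro x hx
    obtain ⟨y, -, rfl⟩ := List.mem_map.1 hx
    exact hC (.inl ⟨y, rfl⟩)
  have h := encodes_nil.update hmem
  rw [List.map_map] at h
  exact ⟨rfl, rfl, h⟩

end StackCode

/-- An arbitrary enumeration of a finite type. -/
@[reducible]
noncomputable def primcodableOfFinite (α : Type*) [Finite α] : Primcodable α :=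
  Primcodable.ofEquiv _ (Finite.equivFin α)

theorem exists_primrecRel_halted [Finite β] [Primcodable β] (M : TM2ComputableAux β γ) :
    ∃ halted : List β → ℕ → Prop, PrimrecRel halted ∧
      ∀ w t u, OutputsAfter M t w u → ∀ j, halted w j ↔ t ≤ j := by
  have := M.tm.kFin
  have := M.tm.ΛFin
  have := M.tm.σFin
  let := primcodableOfFinite M.tm.Λ
  let := primcodableOfFinite M.tm.σ
  obtain ⟨n, m, C, hC⟩ := StackCode.exists_subset_readable (finite_usedSymbols M)
  have hstart : Primrec C.start :=
    (Primrec.const _).pair ((Primrec.const _).pair (primrec_update_fin (Primrec.const _) _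
      (Primrec.list_map Primrec.id
        ((Primrec.dom_finite fun x => C.write M.tm.k₀ (M.inputAlphabet.symm x)).comp
          Primrec.snd).to₂)))
  refine ⟨fun w j => ((C.step M.tm.m)^[j] (C.start w)).1 = none, ?_, fun w t u h => ?_⟩
  · exact Primrec.eq.comp (Primrec.fst.comp (Primrec.nat_iterate Primrec.snd
      (hstart.comp Primrec.fst) ((C.primrec_step M.tm.m).comp Primrec.snd).to₂))
      (Primrec.const none)
  · have hpush (l : M.tm.Λ) : pushedSymbols (M.tm.m l) ⊆ C.readable := fun s hs =>
      hC (.inr (Set.mem_iUnion.2 ⟨l, hs⟩))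
    exact StackCode.iterate_step_halted_iff hpush h rfl (C.represents_start hC w)

theorem exists_computable_time_bound [Finite β] [Primcodable β] (M : TM2ComputableAux β γ)
    {L : ℕ → List (List β)} (hL : Primrec L) (h : ∀ N, ∀ w ∈ L N, ∃ t u, OutputsAfter M t w u) :
    ∃ g : ℕ → ℕ, Computable g ∧ ∀ N, ∀ w ∈ L N, ∀ t u, OutputsAfter M t w u → t ≤ g N := by
  classical
  obtain ⟨halted, hprim, hiff⟩ := exists_primrecRel_halted M
  have hall : PrimrecRel fun N j => ∀ w ∈ L N, halted w j :=
    hprim.forall_mem_list.comp (hL.comp Primrec.fst) Primrec.snd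
  have hex (N : ℕ) : ∃ j, ∀ w ∈ L N, halted w j := by
    choose! t u ht using h N
    refine ⟨((L N).map t).sum, fun w hw => (hiff w _ _ (ht w hw) _).2 ?_⟩
    exact List.single_le_sum (fun _ _ => Nat.zero_le _) _ (List.mem_map_of_mem hw)
  refine ⟨fun N => Nat.find (hex N), Computable.find hall.computablePred hex, ?_⟩
  exact fun N w hw t u hM => (hiff w t u hM _).1 (Nat.find_spec (hex N) w hw)

end TimeBound

section Instances

/-- The words of length at most `N` over the alphabet listed by `as`. -/
def wordsUpTo {α : Type*} (as : List α) : ℕ → List (List α) :=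
  Nat.rec [[]] fun _ ws => [] :: ws.flatMap fun x => as.map (· :: x)

theorem mem_wordsUpTo {α : Type*} {as : List α} {N : ℕ} {x : List α} (hmem : ∀ a ∈ x, a ∈ as)
    (hlen : x.length ≤ N) : x ∈ wordsUpTo as N := by
  induction N generalizing x with
  | zero => simpa [wordsUpTo] using hlen
  | succ N ih =>
    cases x with
    | nil => exact List.mem_cons_self
    | cons a x =>
      obtain ⟨ha, hmem⟩ := List.forall_mem_cons.1 hmem
      refine List.mem_cons_of_mem _ (List.mem_flatMap.2 ⟨x, ih hmem (by simpa using hlen), ?_⟩)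
      exact List.mem_map.2 ⟨a, ha, rfl⟩

theorem primrec_wordsUpTo {α : Type*} [Primcodable α] (as : List α) : Primrec (wordsUpTo as) := by
  refine Primrec.nat_rec₁ _ (Primrec.list_cons.comp (Primrec.const []) ?_)
  exact Primrec.list_flatMap Primrec.snd (Primrec.list_map (Primrec.const as)
    (Primrec.list_cons.comp Primrec.snd (Primrec.snd.comp Primrec.fst)).to₂).to₂

theorem primrec_unaryEncodeNat : Primrec unaryEncodeNat := by
  refine (Primrec.nat_rec₁ (α := List Bool) [] (f := fun _ l => true :: l)
    (Primrec.list_cons.comp (Primrec.const true) Primrec.snd)).of_eq fun n => ?_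
  induction n with
  | zero => rfl
  | succ n ih => exact congrArg _ ih

theorem primrec_instanceEncoding_encode {α : Type} [Primcodable α] :
    Primrec (instanceEncoding α).encode :=
  Primrec.list_append.comp
    (Primrec.list_map Primrec.fst (Primrec.sumInl.comp Primrec.snd).to₂)
    (Primrec.list_map (primrec_unaryEncodeNat.comp Primrec.snd)
      (Primrec.sumInr.comp Primrec.snd).to₂)

/-- The encodings of the instances `(x, k)` such that `x` is a word over the alphabet listed by `as`
and `|x|, k ≤ N`. -/
def instancesUpTo {α : Type} (as : List α) (N : ℕ) : List (List (α ⊕ Bool)) :=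
  (wordsUpTo as N).flatMap fun x =>
    (List.range (N + 1)).map fun k => (instanceEncoding α).encode (x, k)

theorem encode_mem_instancesUpTo {α : Type} {as : List α} {N k : ℕ} {x : List α}
    (hmem : ∀ a ∈ x, a ∈ as) (hx : x.length ≤ N) (hk : k ≤ N) :
    (instanceEncoding α).encode (x, k) ∈ instancesUpTo as N :=
  List.mem_flatMap.2 ⟨x, mem_wordsUpTo hmem hx,
    List.mem_map.2 ⟨k, List.mem_range.2 (Nat.lt_succ_iff.2 hk), rfl⟩⟩

theorem exists_encode_eq_of_mem_instancesUpTo {α : Type} {as : List α} {N : ℕ}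
    {w : List (α ⊕ Bool)} (hw : w ∈ instancesUpTo as N) :
    ∃ y, (instanceEncoding α).encode y = w := by
  obtain ⟨x, -, hw⟩ := List.mem_flatMap.1 hw
  obtain ⟨k, -, h⟩ := List.mem_map.1 hw
  exact ⟨(x, k), h⟩

theorem primrec_instancesUpTo {α : Type} [Primcodable α] (as : List α) :
    Primrec (instancesUpTo as) :=
  Primrec.list_flatMap (primrec_wordsUpTo as) (Primrec.list_map
    (Primrec.list_range.comp (Primrec.succ.comp Primrec.fst))
    (primrec_instanceEncoding_encode.comp
      ((Primrec.snd.comp Primrec.fst).pair Primrec.snd)).to₂).to₂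

theorem exists_computable_time_bound_of_le {α γ : Type} [Finite α]
    (M : TM2ComputableAux (α ⊕ Bool) γ)
    (h : ∀ y, ∃ t u, OutputsAfter M t ((instanceEncoding α).encode y) u) :
    ∃ g : ℕ → ℕ, Computable g ∧ ∀ N x k, x.length ≤ N → k ≤ N → ∀ t u,
      OutputsAfter M t ((instanceEncoding α).encode (x, k)) u → t ≤ g N := by
  let := primcodableOfFinite α
  obtain ⟨as, has⟩ := Finite.exists_univ_list α
  obtain ⟨g, hg, hbound⟩ := exists_computable_time_bound M (primrec_instancesUpTo as)
    fun N w hw => by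
      obtain ⟨y, rfl⟩ := exists_encode_eq_of_mem_instancesUpTo hw
      exact h y
  exact ⟨g, hg, fun N x k hx hk =>
    hbound N _ (encode_mem_instancesUpTo (fun a _ => has.2 a) hx hk)⟩

end Instances

theorem eval_le_eval_one_mul_pow (p : Polynomial ℕ) (n : ℕ) :
    p.eval n ≤ p.eval 1 * (n + 1) ^ p.natDegree := by
  rw [Polynomial.eval_eq_sum_range, Polynomial.eval_eq_sum_range, Finset.sum_mul]
  refine Finset.sum_le_sum fun i hi => ?_
  rw [one_pow, mul_one]
  refine Nat.mul_le_mul_left _ ?_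
  calc n ^ i ≤ (n + 1) ^ i := Nat.pow_le_pow_left n.le_succ i
    _ ≤ (n + 1) ^ p.natDegree :=
      Nat.pow_le_pow_right n.succ_pos (Nat.lt_succ_iff.1 (Finset.mem_range.1 hi))

theorem eval_add_le_mul_max_pow (p : Polynomial ℕ) (n k : ℕ) :
    p.eval (n + k) ≤ p.eval 1 * (k + 2) ^ p.natDegree * max n 1 ^ p.natDegree := by
  rw [mul_assoc, ← mul_pow]
  refine (eval_le_eval_one_mul_pow p _).trans ?_
  gcongr
  calc n + k + 1 = n + (k + 1) * 1 := by ring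
    _ ≤ max n 1 + (k + 1) * max n 1 := by gcongr <;> simp
    _ = (k + 2) * max n 1 := by ring

theorem lt_of_pow_succ_le_mul_max_pow {n k c F : ℕ}
    (h : (n + k + 1) ^ (c + 1) ≤ F * max n 1 ^ c) : n + k < F := by
  refine Nat.le_of_mul_le_mul_right (c := (n + k + 1) ^ c) ?_ (by positivity)
  calc (n + k + 1) * (n + k + 1) ^ c = (n + k + 1) ^ (c + 1) := (pow_succ' _ _).symm
    _ ≤ F * max n 1 ^ c := h
    _ ≤ F * (n + k + 1) ^ c := by
      gcongr
      omega

theorem computable_mul_pow_add {f g : ℕ → ℕ} (hf : Computable f) (hg : Computable g) (a d : ℕ) :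
    Computable fun k => a * (k + 2) ^ d + g (f k) := by
  have hpow : Primrec₂ fun m n : ℕ => m ^ n := Primrec₂.unpaired'.1 Nat.Primrec.pow
  have hmul : Primrec fun k : ℕ => a * (k + 2) ^ d :=
    Primrec.nat_mul.comp (Primrec.const a)
      (hpow.comp (Primrec.succ.comp Primrec.succ) (Primrec.const d))
  exact Primrec.nat_add.to_comp.comp hmul.to_comp (hg.comp hf)

section Kernels

variable {α : Type} [Finite α] {P : List α × ℕ → ℕ}

theorem FPTCounting.hasCountingKernel (h : FPTCounting P) : HasCountingKernel P := by
  obtain ⟨f, hf, M, c, hM⟩ := h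
  have : Inhabited (α ⊕ Bool) := ⟨.inr false⟩
  simp only [nonempty_TM2OutputsInTime_iff] at hM
  choose t ht hrun using hM
  let clock (x : List α) (k : ℕ) : ℕ := (x.length + k + 1) ^ (c + 1)
  let A (y : List α × ℕ) : ℕ ⊕ (List α × ℕ) :=
    if t y.1 y.2 < clock y.1 y.2 then .inl (P y) else .inr y
  obtain ⟨N, p, hN⟩ := exists_clocked M (c + 1)
  refine ⟨f, hf, A, ⟨⟨N, p, fun ⟨x, k⟩ => Nonempty.some ?_⟩⟩, fun x k => ?_⟩
  · refine nonempty_TM2OutputsInTime_iff.2 ?_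
    rw [encodingSum_encode]
    have hclock := hN _ _ _ (hrun x k)
    simpa only [A, clock, apply_ite (Sum.map _ _), Sum.map_inl, Sum.map_inr,
      length_instanceEncoding] using hclock
  · by_cases hlt : t x k < clock x k
    · exact .inl (if_pos hlt)
    · have hsize : x.length + k < f k :=
        lt_of_pow_succ_le_mul_max_pow ((not_lt.1 hlt).trans (ht x k))
      exact .inr ⟨x, k, if_neg hlt, by omega, by omega, rfl⟩

theorem HasCountingKernel.fptCounting (hP : ComputableCounting P) (h : HasCountingKernel P) :
    FPTCounting P := by
  obtain ⟨f, hf, A, ⟨K⟩, hA⟩ := h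
  obtain ⟨Q⟩ := hP
  have : Inhabited (α ⊕ Bool) := ⟨.inr false⟩
  have hQ (y : List α × ℕ) : ∃ t, OutputsAfter Q.toTM2ComputableAux t
      ((instanceEncoding α).encode y) (encodingNatBool.encode (P y)) := by
    obtain ⟨t, -, ht⟩ := nonempty_TM2OutputsInTime_iff.1 ⟨⟨Q.outputsFun y, le_rfl⟩⟩
    exact ⟨t, ht⟩
  obtain ⟨g, hg, hgQ⟩ := exists_computable_time_bound_of_le Q.toTM2ComputableAux fun y =>
    let ⟨t, ht⟩ := hQ y
    ⟨t, _, ht⟩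
  obtain ⟨N, p, hN⟩ := exists_handoff K.toTM2ComputableAux Q.toTM2ComputableAux K.time
  refine ⟨_, computable_mul_pow_add hf hg (p.eval 1) p.natDegree, N, p.natDegree, fun x k => ?_⟩
  rw [nonempty_TM2OutputsInTime_iff, add_mul]
  obtain ⟨hleft, hright⟩ := hN ((instanceEncoding α).encode (x, k))
  have hK := nonempty_TM2OutputsInTime_iff.1 ⟨K.outputsFun (x, k)⟩
  have hp := eval_add_le_mul_max_pow p x.length k
  rw [encodingSum_encode] at hK
  rw [← length_instanceEncoding] at hp
  rcases hA x k with hxk | ⟨x', k', hxk, hx', hk', hPeq⟩ <;> rw [hxk] at hK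
  · exact (hleft _ hK).mono (hp.trans (Nat.le_add_right _ _))
  · obtain ⟨t, ht⟩ := hQ (x', k')
    have hpow : 1 ≤ max x.length 1 ^ p.natDegree := Nat.one_le_pow _ _ (by positivity)
    have htime : t ≤ g (f k) * max x.length 1 ^ p.natDegree :=
      (hgQ _ _ _ hx' hk' _ _ ht).trans (Nat.le_mul_of_pos_right _ hpow)
    rw [hPeq]
    exact (hright _ _ _ hK ht.within).mono (Nat.add_le_add hp htime)

end Kernels

theorem mainTheorem8 {α : Type} [Finite α] (P : List α × ℕ → ℕ) (hP : ComputableCounting P) :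
    FPTCounting P ↔ HasCountingKernel P :=
  ⟨FPTCounting.hasCountingKernel, HasCountingKernel.fptCounting hP⟩
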